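/- **Definitions.** A clustering instance $(\mathcal X,\mathcal P,d)$ is a metric space $(\mathcal X,d)$ with a finite subset $\mathcal P\subset\mathcal X$; put $n=|\mathcal P|$. For a non-empty $C\subset\mathcal P$ and $c\in\mathcal X$ let $\mathsf{rad}(C,c)=\max_{p\in C}d(c,p)$, and $$\mathsf{diam}(C)=\max_{p,q\in C}d(p,q),\qquad \mathsf{rad}(C)=\inf_{c\in\mathcal X}\mathsf{rad}(C,c),\qquad \mathsf{drad}(C)=\min_{c\in C}\mathsf{rad}(C,c).$$ An $i$-clustering is a partition of $\mathcal P$ into at most $i$ non-empty clusters; its cost, for $\mathsf{cost}\in\{\mathsf{diam},\mathsf{rad},\mathsf{drad}\}$, is the maximum cost of its clusters, and $\mathcal O_i$ denotes an $i$-clustering of minimum cost. A hierarchical clustering is a sequence $\mathscr H=(\mathcal H_n,\dots,\mathcal H_1)$ in which $\mathcal H_i$ is an $i$-clustering of $\mathcal P$ and, for $1<i\le n$, every cluster of $\mathcal H_i$ is contained in a cluster of $\mathcal H_{i-1}$. It is an $\alpha$-approximation with respect to $\mathsf{cost}$ if $\mathsf{cost}(\mathcal H_i)\le\alpha\cdot\mathsf{cost}(\mathcal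 O_i)$ for all $1\le i\le n$. The price of hierarchy $\rho_{\mathsf{cost}}\ge1$ is the number such that every instance has a hierarchical clustering that is a $\rho_{\mathsf{cost}}$-approximation, while for every $\alpha<\rho_{\mathsf{cost}}$ some instance has no hierarchical clustering that is an $\alpha$-approximation. **The layered instances.** Let $k\in\mathbb N$, $\Gamma=k+1$. Let $\mathcal Q_0=\mathcal P_0=[1]$, $N_0=1$, and for $1\le\ell\le k$ let $\mathcal Q_\ell=[\Gamma N_{\ell-1}]^{N_{\ell-1}}$, $\mathcal P_\ell=\prod_{i=0}^{\ell}\mathcal Q_i$, $N_\ell=|\mathcal P_\ell|$. Fix bijections $\phi_\ell:\mathcal P_\ell\to[N_\ell]$. For $X=(X_0,\dots,X_k)\in\mathcal P_k$ and $1\le\ell\le k$ let $A^X_\ell$ be the set of all $Y\in\mathcal P_k$ that agree with $X$ except possibly in the entry of row $\ell$ at position $\phi_{\ell-1}(X_0,\dots,X_{\ell-1})$, and let $\mathcal A_\ell=\{A^X_\ell: X\in\mathcal P_k\}$. Let $\mathcal X$ consist of $\mathcal P_k$ and one extra vertex $v_A$ for each $A\in\bigcup_{\ell=1}^k\mathcal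 A_\ell$. Consider the weighted hypergraph on $\mathcal X$ with hyperedges $A$ of weight $\ell$ and $\{v,v_A\}$ of weight $\ell/2$, for all $1\le\ell\le k$, $A\in\mathcal A_\ell$, $v\in A$. The layered instance for $k$ and $(\phi_\ell)$ is $(\mathcal X,\mathcal P_k,d)$, where $d$ is the shortest-path distance in this hypergraph. **Theorem.** 1. $\rho_{\mathsf{diam}}=\rho_{\mathsf{rad}}=3+2\sqrt2$. 2. $\rho_{\mathsf{drad}}$ exists, and $\rho_{\mathsf{drad}}\ge4$. 3. For every $\varepsilon>0$ there is a $k\in\mathbb N$ such that for every choice of the bijections $\phi_\ell$ the distance $d$ above is a (finite) metric, and on the layered instance for $k$ and $(\phi_\ell)$ no hierarchical clustering is a $(3+2\sqrt2-\varepsilon)$-approximation with respect to $\mathsf{diam}$ or with respect to $\mathsf{rad}$, and none is a $(4-\varepsilon)$-approximation with respect to $\mathsf{drad}$. -/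

import Mathlib

noncomputable section

/-! ### Objectives

An objective assigns a real cost to every finite subset of every metric space. -/

abbrev Objective : Type 1 := (X : Type) → [MetricSpace X] → Finset X → ℝ

/-- The diameter `max_{p, q ∈ C} d(p, q)` of a cluster. -/
def diamCost : Objective := fun X _ C => Metric.diam (C : Set X)

/-- `max_{p ∈ C} d(c, p)`, the radius of the cluster `C` with respect to the center `c`. -/
def radiusAt {X : Type} [MetricSpace X] (C : Finset X) (c : X) : ℝ :=
  ⨆ p : {p : X // p ∈ C}, dist c p.1

/-- The radius of a cluster: the center may be any point of the ambient metric space. -/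
def radCost : Objective := fun X _ C => ⨅ c : X, radiusAt C c

/-- The discrete radius of a cluster: the center has to be a point of the cluster. -/
def dradCost : Objective := fun X _ C => ⨅ c : {c : X // c ∈ C}, radiusAt C c.1

/-! ### Clusterings and hierarchical clusterings

A clustering of the finite set `P` is a `Finpartition P`, a partition into non-empty parts. -/

open scoped Classical in
/-- The cost of a clustering is the maximum cost of one of its clusters. -/
def clusteringCost (cost : Objective) {X : Type} [MetricSpace X] {P : Finset X}
    (𝒞 : Finpartition P) : ℝ :=
  ⨆ C : {C : Finset X // C ∈ 𝒞.parts}, cost X C.1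

open scoped Classical in
/-- `𝒪` is an optimal `i`-clustering: it has at most `i` clusters, and minimal cost among the
clusterings with at most `i` clusters. -/
def IsOptimalClustering (cost : Objective) {X : Type} [MetricSpace X] {P : Finset X}
    (i : ℕ) (𝒪 : Finpartition P) : Prop :=
  𝒪.parts.card ≤ i ∧
    ∀ 𝒞 : Finpartition P, 𝒞.parts.card ≤ i → clusteringCost cost 𝒪 ≤ clusteringCost cost 𝒞

open scoped Classical in
/-- A hierarchical clustering of `P`, with `n = |P|`: a sequence `level n, …, level 1`, where
`level i` has at most `i` clusters and every cluster of `level (i + 1)` is contained in a cluster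
of `level i` (this is what `≤` means for `Finpartition`). The values of `level` at indices outside
`1, …, n` play no role. -/
structure HierarchicalClustering {X : Type} (P : Finset X) where
  level : ℕ → Finpartition P
  card_level : ∀ i, 1 ≤ i → i ≤ P.card → (level i).parts.card ≤ i
  refines : ∀ i, 1 ≤ i → i < P.card → level (i + 1) ≤ level i

open scoped Classical in
/-- `H` is an `α`-approximation: on every level `i = 1, …, |P|` its cost is at most `α` times the
cost of an optimal `i`-clustering. -/
def HierarchicalClustering.IsApproximation {X : Type} [MetricSpace X] {P : Finset X}
    (H : HierarchicalClustering P) (cost : Objective) (α : ℝ) : Prop :=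
  ∀ i, 1 ≤ i → i ≤ P.card → ∀ 𝒪 : Finpartition P, IsOptimalClustering cost i 𝒪 →
    clusteringCost cost (H.level i) ≤ α * clusteringCost cost 𝒪

/-- `ρ` is the price of hierarchy of `cost`. -/
def IsPriceOfHierarchy (cost : Objective) (ρ : ℝ) : Prop :=
  1 ≤ ρ ∧
  (∀ (X : Type) [MetricSpace X] (P : Finset X),
    ∃ H : HierarchicalClustering P, H.IsApproximation cost ρ) ∧
  (∀ α : ℝ, α < ρ → ∃ (X : Type) (_ : MetricSpace X) (P : Finset X),
    ¬ ∃ H : HierarchicalClustering P, H.IsApproximation cost α)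

/-! ### Weighted hypergraphs and shortest paths -/

/-- A weighted hypergraph on the vertex type `V`, with hyperedges indexed by `E`. -/
structure WeightedHypergraph (V E : Type) where
  verts : E → Set V
  weight : E → ℝ

/-- `G.IsWalkLength u v L`: some walk from `u` to `v`, in which any two consecutive vertices lie in
a common hyperedge, has total weight `L`. -/
inductive WeightedHypergraph.IsWalkLength {V E : Type} (G : WeightedHypergraph V E) :
    V → V → ℝ → Prop
  | nil (v : V) : G.IsWalkLength v v 0
  | cons {u v w : V} {L : ℝ} (e : E) (hu : u ∈ G.verts e) (hv : v ∈ G.verts e)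
      (h : G.IsWalkLength v w L) : G.IsWalkLength u w (G.weight e + L)

/-- `d(u, v)` is the length of a shortest path from `u` to `v`, for all `u` and `v` (in particular
such a path exists). -/
def WeightedHypergraph.IsShortestPathMetric {V E : Type} (G : WeightedHypergraph V E)
    (m : MetricSpace V) : Prop :=
  ∀ u v : V, IsLeast {L : ℝ | G.IsWalkLength u v L} (m.dist u v)

/-! ### The layered hypergraph over product point sets -/

/-- The numbers `N_0 = 1`, `N_{ℓ+1} = N_ℓ * (Γ N_ℓ) ^ N_ℓ`. -/
def layerCard (Γ : ℕ) : ℕ → ℕ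
  | 0 => 1
  | ℓ + 1 => layerCard Γ ℓ * (Γ * layerCard Γ ℓ) ^ layerCard Γ ℓ

/-- The point set `𝒫_ℓ = 𝒬_0 × 𝒬_1 × ⋯ × 𝒬_ℓ`, where `𝒬_0` is a one-point set and
`𝒬_{i+1} = [Γ N_i]^{N_i}`. The constant row `0` is left out, so that index `i` is row `i + 1`. -/
abbrev LayerPoint (Γ ℓ : ℕ) : Type :=
  (i : Fin ℓ) → Fin (layerCard Γ i) → Fin (Γ * layerCard Γ i)

theorem card_layerPoint (Γ ℓ : ℕ) : Fintype.card (LayerPoint Γ ℓ) = layerCard Γ ℓ := by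
  induction ℓ with
  | zero => simp [layerCard]
  | succ ℓ ih =>
    simp only [Fintype.card_pi, Fintype.card_fin, Finset.prod_const, Finset.card_univ] at ih ⊢
    rw [Fin.prod_univ_castSucc]
    simp only [Fin.val_castSucc, Fin.val_last]
    rw [ih, layerCard]

/-- The first rows of `X`, those of index smaller than `j`. -/
def rowsBelow {Γ k : ℕ} (X : LayerPoint Γ k) (j : Fin k) : LayerPoint Γ j :=
  fun i => X ⟨i.1, i.2.trans j.2⟩

/-- Bijections `φ_ℓ : 𝒫_ℓ → [N_ℓ]`. -/
abbrev LayerNumbering (Γ : ℕ) : Type := (ℓ : ℕ) → LayerPoint Γ ℓ ≃ Fin (layerCard Γ ℓ)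

/-- The set of all points that agree with `X` except possibly in one entry of row `j`, namely the
entry whose position is the number of the rows of `X` below `j`. -/
def line {Γ k : ℕ} (φ : LayerNumbering Γ) (j : Fin k) (X : LayerPoint Γ k) :
    Set (LayerPoint Γ k) :=
  {Y | (∀ i, i ≠ j → Y i = X i) ∧ ∀ s, s ≠ φ j (rowsBelow X j) → Y j s = X j s}

/-- The family of all these sets, for a fixed row. -/
def lines {Γ k : ℕ} (φ : LayerNumbering Γ) (j : Fin k) : Set (Set (LayerPoint Γ k)) :=
  Set.range (line φ j)

/-- The vertices: the points, and one additional vertex `v_A` for every set `A` as above. -/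
abbrev LayeredVertex {Γ : ℕ} (k : ℕ) (φ : LayerNumbering Γ) : Type :=
  LayerPoint Γ k ⊕ (Σ j : Fin k, ↥(lines φ j))

/-- The hyperedges: the sets `A`, and the pairs `{v, v_A}` with `v ∈ A`. -/
abbrev LayeredEdge {Γ : ℕ} (k : ℕ) (φ : LayerNumbering Γ) : Type :=
  (Σ j : Fin k, ↥(lines φ j)) ⊕ (Σ a : (Σ j : Fin k, ↥(lines φ j)), ↥(a.2.1))

/-- The layered hypergraph. A set `A` that belongs to row `j + 1` of the product has weight
`j + 1`, and the pairs `{v, v_A}` have half of this weight. -/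
def layeredHypergraph {Γ : ℕ} (k : ℕ) (φ : LayerNumbering Γ) :
    WeightedHypergraph (LayeredVertex k φ) (LayeredEdge k φ) where
  verts
    | .inl a => Sum.inl '' a.2.1
    | .inr ⟨a, v⟩ => {Sum.inl v.1, Sum.inr a}
  weight
    | .inl a => (a.1 : ℝ) + 1
    | .inr ⟨a, _⟩ => ((a.1 : ℝ) + 1) / 2

/-- The set to be clustered consists of the points, without the additional vertices. -/
def layeredPoints {Γ : ℕ} (k : ℕ) (φ : LayerNumbering Γ) : Finset (LayeredVertex k φ) :=
  (Finset.univ : Finset (LayerPoint Γ k)).map Function.Embedding.inl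

end

/-!
**Upper bounds.** A hierarchy is built by composing maps. For thresholds `T 1 < T 2 < …` choose
coarsest clusterings `𝒢 j` of cost at most `T j`, and let `rep j` contract each cluster of `𝒢 j` to
one of its points. The fibers of `rep j ∘ ⋯ ∘ rep 1` get coarser with `j`, and there are at most as
many of them as clusters of `𝒢 j`. Since `rep i` moves points by at most the diameter of a cluster
of `𝒢 i`, such a fiber consists of points that moved by a sum of these diameters into one cluster of
`𝒢 j`. For the diameter this gives the cost `T j + 2 (T 1 + ⋯ + T (j - 1))`, and the radius, being at
least half of the diameter, leads to the same expression. If `T j` is proportional to `β ^ j`, each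
level `i` uses the first `j` for which an `i`-clustering of cost at most `T j` exists, so the optimum
exceeds `T (j - 1)`, and the factor is `β (β + 1) / (β - 1)`. This is `3 + 2 √2` for `β = 1 + √2`
(`IsTransportBounded.exists_isApproximation`). The discrete radius loses a further factor of at
most `2`, so that its price is the infimum of a non-empty set of factors; the infimum is attained,
as the hierarchies of an instance form finitely many classes (`exists_isApproximation_of_forall_gt`).

**Lower bounds.** Row `t` of a layered instance has so few lines that, for `Γ = k + 1`, all but the
fraction `1 / (k + 1)` of the points lie in clusters with more than `N_t` points;
`exists_heavy_subset` finds points for which this holds on all levels. By the pigeonhole principle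
a cluster of this size varies in some row `j ≥ t`. An entry of row `j` can only be changed at the
place that its position encodes, so when two subclusters without variation in row `j` but with
different entries are joined, their union has diameter at least `j + 1` plus both distances to
that place, and its eccentricity from any point is at least `j + 1` plus one such distance
(`exists_growth_step`). Let `E t` be the least eccentricity of a cluster at time `t`. If the
factor is `α`, then for each `t ≥ 1` there is an `s ≤ t` with `E t ≥ t + E (s - 1)` and
`t + κ * E (s - 1) ≤ α * s`, where `κ = 2` for the diameter and the radius, and `κ = 1` for the
discrete radius. A bound `E t ≥ c t - d` thus improves to one of slope `1 + c / (α - κ c)`. This map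
has no fixed point when `(α + κ - 1) ^ 2 < 4 κ α`, that is, when `α ^ 2 - 6 α + 1 < 0` or
`α ^ 2 < 4 α`. The larger roots of these polynomials are the constants `3 + 2 √2` and `4`, and
below them the slopes grow until the second inequality fails (`exists_forall_ge_growth_absurd`).
-/

/-! ### Costs of clusters and of clusterings -/

theorem dist_le_diamCost {X : Type} [MetricSpace X] {C : Finset X} {p q : X}
    (hp : p ∈ C) (hq : q ∈ C) : dist p q ≤ diamCost X C :=
  Metric.dist_le_diam_of_mem C.finite_toSet.isBounded (by simpa using hp) (by simpa using hq)

theorem diamCost_le {X : Type} [MetricSpace X] {C : Finset X} {r : ℝ} (hr : 0 ≤ r)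
    (h : ∀ p ∈ C, ∀ q ∈ C, dist p q ≤ r) : diamCost X C ≤ r :=
  Metric.diam_le_of_forall_dist_le hr fun p hp q hq =>
    h p (by simpa using hp) q (by simpa using hq)

theorem dist_le_radiusAt {X : Type} [MetricSpace X] {C : Finset X} {c p : X} (hp : p ∈ C) :
    dist c p ≤ radiusAt C c :=
  le_ciSup (f := fun p : {p : X // p ∈ C} => dist c p.1) (Set.finite_range _).bddAbove ⟨p, hp⟩

theorem radiusAt_le {X : Type} [MetricSpace X] {C : Finset X} {c : X} {r : ℝ} (hr : 0 ≤ r)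
    (h : ∀ p ∈ C, dist c p ≤ r) : radiusAt C c ≤ r :=
  Real.iSup_le (fun p => h p.1 p.2) hr

theorem radiusAt_nonneg {X : Type} [MetricSpace X] (C : Finset X) (c : X) : 0 ≤ radiusAt C c :=
  Real.iSup_nonneg fun _ => dist_nonneg

theorem radCost_le_radiusAt {X : Type} [MetricSpace X] (C : Finset X) (c : X) :
    radCost X C ≤ radiusAt C c :=
  ciInf_le ⟨0, by rintro _ ⟨c, rfl⟩; exact radiusAt_nonneg C c⟩ c

theorem dradCost_le_radiusAt {X : Type} [MetricSpace X] {C : Finset X} {c : X} (hc : c ∈ C) :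
    dradCost X C ≤ radiusAt C c :=
  ciInf_le (f := fun c : {c : X // c ∈ C} => radiusAt C c.1)
    ⟨0, by rintro _ ⟨c, rfl⟩; exact radiusAt_nonneg C c.1⟩ ⟨c, hc⟩

theorem le_dradCost {X : Type} [MetricSpace X] {C : Finset X} (hC : C.Nonempty) {r : ℝ}
    (h : ∀ c ∈ C, r ≤ radiusAt C c) : r ≤ dradCost X C :=
  haveI : Nonempty {c : X // c ∈ C} := hC.to_subtype
  le_ciInf fun c => h c.1 c.2

theorem dist_le_two_mul_radiusAt {X : Type} [MetricSpace X] {C : Finset X} {p q : X}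
    (hp : p ∈ C) (hq : q ∈ C) (c : X) : dist p q ≤ 2 * radiusAt C c := by
  have h1 := dist_le_radiusAt (c := c) hp
  have h2 := dist_le_radiusAt (c := c) hq
  have := dist_triangle_left p q c
  linarith

theorem dist_le_two_mul_radCost {X : Type} [MetricSpace X] {C : Finset X} {p q : X}
    (hp : p ∈ C) (hq : q ∈ C) : dist p q ≤ 2 * radCost X C := by
  have : dist p q / 2 ≤ radCost X C :=
    haveI : Nonempty X := ⟨p⟩
    le_ciInf fun c => by linarith [dist_le_two_mul_radiusAt hp hq c]
  linarith

theorem dist_le_two_mul_dradCost {X : Type} [MetricSpace X] {C : Finset X} {p q : X}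
    (hp : p ∈ C) (hq : q ∈ C) : dist p q ≤ 2 * dradCost X C := by
  have : dist p q / 2 ≤ dradCost X C :=
    le_dradCost ⟨p, hp⟩ fun c _ => by linarith [dist_le_two_mul_radiusAt hp hq c]
  linarith

open scoped Classical in
theorem cost_le_clusteringCost (cost : Objective) {X : Type} [MetricSpace X] {P : Finset X}
    (𝒞 : Finpartition P) {C : Finset X} (hC : C ∈ 𝒞.parts) :
    cost X C ≤ clusteringCost cost 𝒞 :=
  le_ciSup (f := fun C : {C : Finset X // C ∈ 𝒞.parts} => cost X C.1)
    (Set.finite_range _).bddAbove ⟨C, hC⟩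

open scoped Classical in
theorem clusteringCost_le (cost : Objective) {X : Type} [MetricSpace X] {P : Finset X}
    (𝒞 : Finpartition P) {r : ℝ} (hr : 0 ≤ r) (h : ∀ C ∈ 𝒞.parts, cost X C ≤ r) :
    clusteringCost cost 𝒞 ≤ r :=
  Real.iSup_le (fun C => h C.1 C.2) hr

open scoped Classical in
/-- The partition of `P` into the non-empty fibers of `f`. -/
noncomputable def fiberPartition {X Y : Type} (P : Finset X) (f : X → Y) : Finpartition P :=
  Finpartition.ofSetSetoid (Setoid.ker f) P

open scoped Classical in
theorem mem_fiberPartition_parts {X Y : Type} {P : Finset X} {f : X → Y} {C : Finset X} :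
    C ∈ (fiberPartition P f).parts ↔ ∃ a ∈ P, C = {b ∈ P | f a = f b} := by
  simp only [fiberPartition, Finpartition.ofSetSetoid_parts, Finset.mem_image]
  exact exists_congr fun a => and_congr_right fun _ => eq_comm

open scoped Classical in
theorem card_fiberPartition_parts_le {X Y : Type} (P : Finset X) (f : X → Y) :
    (fiberPartition P f).parts.card ≤ (P.image f).card := by
  have : (fiberPartition P f).parts ⊆ (P.image f).image fun y => {b ∈ P | y = f b} := by
    intro C hC
    obtain ⟨a, ha, rfl⟩ := mem_fiberPartition_parts.1 hC
    exact Finset.mem_image_of_mem _ (Finset.mem_image_of_mem f ha)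
  exact (Finset.card_le_card this).trans Finset.card_image_le

open scoped Classical in
theorem fiberPartition_mono {X Y Z : Type} {P : Finset X} {f : X → Y} {g : X → Z}
    (h : ∀ a b, f a = f b → g a = g b) : fiberPartition P f ≤ fiberPartition P g := by
  intro C hC
  obtain ⟨a, ha, rfl⟩ := mem_fiberPartition_parts.1 hC
  exact ⟨_, mem_fiberPartition_parts.2 ⟨a, ha, rfl⟩, fun b hb => by
    simp only [Finset.mem_filter] at hb ⊢
    exact ⟨hb.1, h _ _ hb.2⟩⟩

/-! ### Hierarchies obtained by composing optimal clusterings -/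

/-- The properties of an objective on which the upper bound rests: two points of a cluster have
distance at most `s` times its cost, and if every point of `U` can be moved into `C` by a distance
of at most `s * δ`, then `U` costs at most `A` times as much as `C` enlarged by `2 * δ`. -/
structure IsTransportBounded (cost : Objective) (s A : ℝ) : Prop where
  s_pos : 0 < s
  A_nonneg : 0 ≤ A
  singleton_le : ∀ (X : Type) [MetricSpace X] (p : X), cost X {p} ≤ 0
  dist_le : ∀ (X : Type) [MetricSpace X] (C : Finset X) (p q : X), p ∈ C → q ∈ C →
    dist p q ≤ s * cost X C
  cost_le : ∀ (X : Type) [MetricSpace X] (U C : Finset X) (f : X → X) (δ : ℝ), U.Nonempty →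
    (∀ p ∈ U, f p ∈ C ∧ dist p (f p) ≤ s * δ) → cost X U ≤ A * (cost X C + 2 * δ)

open scoped Classical in
theorem clusteringCost_nonneg {cost : Objective} {s A : ℝ} (hc : IsTransportBounded cost s A)
    {X : Type} [MetricSpace X] {P : Finset X} (𝒞 : Finpartition P) :
    0 ≤ clusteringCost cost 𝒞 := by
  refine Real.iSup_nonneg fun C => ?_
  obtain ⟨p, hp⟩ := 𝒞.nonempty_of_mem_parts C.2
  have := hc.dist_le X C.1 p p hp hp
  rw [dist_self] at this
  exact nonneg_of_mul_nonneg_right this hc.s_pos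

theorem isTransportBounded_diamCost : IsTransportBounded diamCost 1 1 where
  s_pos := one_pos
  A_nonneg := zero_le_one
  singleton_le X _ p := diamCost_le le_rfl (by simp)
  dist_le X _ C p q hp hq := by rw [one_mul]; exact dist_le_diamCost hp hq
  cost_le X _ U C f δ hU h := by
    have key : ∀ p ∈ U, ∀ q ∈ U, dist p q ≤ 1 * (diamCost X C + 2 * δ) := fun p hp q hq => by
      obtain ⟨h1, h2⟩ := h p hp
      obtain ⟨h3, h4⟩ := h q hq
      have := dist_triangle4 p (f p) (f q) q
      have := dist_le_diamCost h1 h3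
      rw [dist_comm q] at h4
      linarith
    obtain ⟨p, hp⟩ := hU
    exact diamCost_le (dist_nonneg.trans (key p hp p hp)) key

theorem isTransportBounded_radCost : IsTransportBounded radCost 2 1 where
  s_pos := two_pos
  A_nonneg := zero_le_one
  singleton_le X _ p :=
    (radCost_le_radiusAt _ p).trans (radiusAt_le le_rfl (by simp))
  dist_le X _ C p q hp hq := dist_le_two_mul_radCost hp hq
  cost_le X _ U C f δ hU h := by
    obtain ⟨p₀, hp₀⟩ := hU
    have : Nonempty X := ⟨p₀⟩
    rw [one_mul, ← sub_le_iff_le_add]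
    refine le_ciInf fun c => ?_
    have key : ∀ p ∈ U, dist c p ≤ radiusAt C c + 2 * δ := fun p hp => by
      obtain ⟨h1, h2⟩ := h p hp
      have := dist_triangle_right c p (f p)
      have := dist_le_radiusAt (c := c) h1
      linarith
    rw [sub_le_iff_le_add]
    exact (radCost_le_radiusAt U c).trans (radiusAt_le (dist_nonneg.trans (key p₀ hp₀)) key)

theorem isTransportBounded_dradCost : IsTransportBounded dradCost 2 2 where
  s_pos := two_pos
  A_nonneg := zero_le_two
  singleton_le X _ p :=
    (dradCost_le_radiusAt (Finset.mem_singleton_self p)).trans (radiusAt_le le_rfl (by simp))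
  dist_le X _ C p q hp hq := dist_le_two_mul_dradCost hp hq
  cost_le X _ U C f δ hU h := by
    obtain ⟨c, hc⟩ := hU
    have key : ∀ p ∈ U, dist c p ≤ 2 * (dradCost X C + 2 * δ) := fun p hp => by
      obtain ⟨h1, h2⟩ := h c hc
      obtain ⟨h3, h4⟩ := h p hp
      have := dist_triangle4 c (f c) (f p) p
      have := dist_le_two_mul_dradCost h1 h3
      rw [dist_comm p] at h4
      linarith
    exact (dradCost_le_radiusAt hc).trans (radiusAt_le (dist_nonneg.trans (key c hc)) key)

open scoped Classical in
/-- A map that contracts every part of a partition to one of its points. -/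
theorem exists_representative {X : Type} {P : Finset X} (𝒢 : Finpartition P) :
    ∃ rep : X → X, (∀ p ∈ P, rep p ∈ 𝒢.part p) ∧
      ∀ p ∈ P, ∀ q ∈ P, rep p = rep q ↔ 𝒢.part p = 𝒢.part q := by
  have hne : ∀ p ∈ P, (𝒢.part p).Nonempty := fun p hp => ⟨p, 𝒢.mem_part_self.2 hp⟩
  let rep : X → X := fun p => if h : (𝒢.part p).Nonempty then h.choose else p
  have hrep : ∀ p ∈ P, rep p ∈ 𝒢.part p := fun p hp => by
    simp only [rep, dif_pos (hne p hp)]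
    exact (hne p hp).choose_spec
  refine ⟨rep, hrep, fun p hp q hq => ⟨fun h => ?_, fun h => ?_⟩⟩
  · exact 𝒢.eq_of_mem_parts (𝒢.part_mem.2 hp) (𝒢.part_mem.2 hq) (hrep p hp) (h ▸ hrep q hq)
  · have := hne q hq
    simp only [rep, h, dif_pos this]

open scoped Classical in
/-- Among the clusterings of cost at most `T` there is one with the least number of clusters. -/
theorem exists_coarsest_of_cost_le {cost : Objective} {s A : ℝ} (hc : IsTransportBounded cost s A)
    {X : Type} [MetricSpace X] (P : Finset X) {T : ℝ} (hT : 0 ≤ T) :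
    ∃ 𝒢 : Finpartition P, clusteringCost cost 𝒢 ≤ T ∧
      ∀ 𝒞 : Finpartition P, clusteringCost cost 𝒞 ≤ T → 𝒢.parts.card ≤ 𝒞.parts.card := by
  have hbot : clusteringCost cost (⊥ : Finpartition P) ≤ T := by
    refine clusteringCost_le cost _ hT fun C hC => ?_
    obtain ⟨a, -, rfl⟩ := Finpartition.mem_bot_iff.1 hC
    exact (hc.singleton_le X a).trans hT
  obtain ⟨𝒢, h1, h2⟩ := Set.exists_min_image {𝒞 : Finpartition P | clusteringCost cost 𝒞 ≤ T}
    (fun 𝒞 => 𝒞.parts.card) (Set.toFinite _) ⟨⊥, hbot⟩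
  exact ⟨𝒢, h1, h2⟩

theorem exists_pos_forall_mul_lt_dist {X : Type} [MetricSpace X] (P : Finset X) (s : ℝ) :
    ∃ T : ℝ, 0 < T ∧ ∀ p ∈ P, ∀ q ∈ P, p ≠ q → s * T < dist p q := by
  have h : ∀ᶠ T in nhdsWithin (0 : ℝ) (Set.Ioi 0), ∀ p ∈ P, ∀ q ∈ P, p ≠ q → s * T < dist p q := by
    refine (Filter.eventually_all_finset P).2 fun p _ =>
      (Filter.eventually_all_finset P).2 fun q _ => ?_
    by_cases hpq : p = q
    · simp [hpq]
    have hcont : Filter.Tendsto (fun T : ℝ => s * T) (nhdsWithin 0 (Set.Ioi 0)) (nhds 0) := by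
      have : ContinuousAt (fun T : ℝ => s * T) 0 := by fun_prop
      simpa [ContinuousAt] using this.mono_left nhdsWithin_le_nhds
    exact (hcont.eventually_lt_const (dist_pos.2 hpq)).mono fun T hT _ => hT
  obtain ⟨T, hT, hT0⟩ := (h.and self_mem_nhdsWithin).exists
  exact ⟨T, hT0, hT⟩

open scoped Classical in
/-- Every instance has a hierarchical clustering whose approximation factor is
`(1 + √2) ^ 2 = 3 + 2 √2`, up to the factor `A` of the objective. With thresholds `T j` growing by
the factor `β = 1 + √2`, the clusters of stage `j + 1` are the sets of points whose stage `j`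
representatives lie in the same cluster of a coarsest clustering of cost at most `T (j + 1)`. -/
theorem IsTransportBounded.exists_isApproximation {cost : Objective} {s A : ℝ}
    (hc : IsTransportBounded cost s A) {X : Type} [MetricSpace X] (P : Finset X) :
    ∃ H : HierarchicalClustering P, H.IsApproximation cost (A * (3 + 2 * Real.sqrt 2)) := by
  obtain ⟨T₀, hT₀, hsep⟩ := exists_pos_forall_mul_lt_dist P s
  set w := Real.sqrt 2 with hw
  have hw2 : w * w = 2 := Real.mul_self_sqrt (by norm_num)
  have hw0 : 0 ≤ w := Real.sqrt_nonneg 2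
  let T : ℕ → ℝ := fun j => T₀ * (1 + w) ^ j
  have hTsucc : ∀ j, T (j + 1) = T j * (1 + w) := fun j => by simp only [T, pow_succ]; ring
  have hTpos : ∀ j, 0 < T j := fun j => by positivity
  choose 𝒢 h𝒢 hmin using fun j => exists_coarsest_of_cost_le hc P (hTpos j).le
  choose rep hrep hrepeq using fun j => exists_representative (𝒢 j)
  -- `F j p` is the representative of `p` at stage `j`.
  let F : ℕ → X → X := fun j => Nat.rec id (fun i g p => rep (i + 1) (g p)) j
  have hFP : ∀ j, ∀ p ∈ P, F j p ∈ P := by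
    intro j
    induction j with
    | zero => exact fun p hp => hp
    | succ j ih => exact fun p hp => (𝒢 (j + 1)).part_subset _ (hrep (j + 1) _ (ih p hp))
  -- The displacements add up to a geometric sum, at most `s * T (j + 1) / √2`.
  have hFdist : ∀ j, ∀ p ∈ P, dist p (F j p) ≤ s * (T (j + 1) * w / 2) := by
    intro j
    induction j with
    | zero =>
      intro p hp
      have := hc.s_pos
      have := hTpos 1
      change dist p p ≤ _
      rw [dist_self]
      positivity
    | succ j ih =>
      intro p hp
      have h1 := ih p hp
      have h2 : dist (F j p) (F (j + 1) p) ≤ s * T (j + 1) := by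
        have hm := hFP j p hp
        refine (hc.dist_le X _ _ _ ((𝒢 (j + 1)).mem_part_self.2 hm) (hrep (j + 1) _ hm)).trans ?_
        exact mul_le_mul_of_nonneg_left
          ((cost_le_clusteringCost cost _ ((𝒢 (j + 1)).part_mem.2 hm)).trans (h𝒢 _)) hc.s_pos.le
      refine (dist_triangle _ _ _).trans ((add_le_add h1 h2).trans (le_of_eq ?_))
      rw [hTsucc (j + 1)]
      linear_combination (-(s * T (j + 1)) / 2) * hw2
  let L : ℕ → Finpartition P := fun j => fiberPartition P (F j)
  have hLmono : Monotone L := monotone_nat_of_le_succ fun j =>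
    fiberPartition_mono fun a b h => congrArg (rep (j + 1)) h
  have hLcard : ∀ j, (L (j + 1)).parts.card ≤ (𝒢 (j + 1)).parts.card := fun j => by
    refine (card_fiberPartition_parts_le P _).trans ?_
    refine Finset.card_le_card_of_injOn (𝒢 (j + 1)).part ?_ ?_
    · intro x hx
      obtain ⟨p, hp, rfl⟩ := Finset.mem_image.1 (Finset.mem_coe.1 hx)
      exact (𝒢 (j + 1)).part_mem.2 (hFP (j + 1) p hp)
    · intro x hx y hy hxy
      obtain ⟨p, hp, rfl⟩ := Finset.mem_image.1 (Finset.mem_coe.1 hx)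
      obtain ⟨q, hq, rfl⟩ := Finset.mem_image.1 (Finset.mem_coe.1 hy)
      have hmem : ∀ r ∈ P, (𝒢 (j + 1)).part (F (j + 1) r) = (𝒢 (j + 1)).part (F j r) :=
        fun r hr => (𝒢 (j + 1)).part_eq_of_mem ((𝒢 (j + 1)).part_mem.2 (hFP j r hr))
          (hrep (j + 1) _ (hFP j r hr))
      rw [hmem p hp, hmem q hq] at hxy
      exact (hrepeq (j + 1) _ (hFP j p hp) _ (hFP j q hq)).2 hxy
  have hLcost : ∀ j, clusteringCost cost (L (j + 1)) ≤ A * (3 + 2 * w) * T j := fun j => by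
    have := hc.A_nonneg
    have hTj := hTpos j
    refine clusteringCost_le cost _ (by positivity) fun C hC => ?_
    obtain ⟨a, ha, rfl⟩ := mem_fiberPartition_parts.1 hC
    have hpart := (𝒢 (j + 1)).part_mem.2 (hFP j a ha)
    refine (hc.cost_le X _ ((𝒢 (j + 1)).part (F j a)) (F j) (T (j + 1) * w / 2) ⟨a, by simp [ha]⟩
      fun p hp => ?_).trans ?_
    · obtain ⟨hp, hap⟩ := Finset.mem_filter.1 hp
      refine ⟨?_, hFdist j p hp⟩
      rw [(hrepeq (j + 1) _ (hFP j a ha) _ (hFP j p hp)).1 hap]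
      exact (𝒢 (j + 1)).mem_part_self.2 (hFP j p hp)
    · rw [mul_assoc A]
      refine mul_le_mul_of_nonneg_left ?_ hc.A_nonneg
      have h1 := (cost_le_clusteringCost cost _ hpart).trans (h𝒢 (j + 1))
      have h2 : T (j + 1) + 2 * (T (j + 1) * w / 2) = (3 + 2 * w) * T j := by
        rw [hTsucc]
        linear_combination T j * hw2
      linarith
  -- Level `i` uses the first stage whose threshold allows for `i` clusters.
  let S : ℕ → Set ℕ := fun i =>
    {j | ∃ 𝒞 : Finpartition P, 𝒞.parts.card ≤ i ∧ clusteringCost cost 𝒞 ≤ T j}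
  have hSne : ∀ i, 1 ≤ i → (S i).Nonempty := by
    intro i hi
    let 𝒞 := fiberPartition P (fun _ => ())
    obtain ⟨j, hj⟩ := pow_unbounded_of_one_lt (clusteringCost cost 𝒞 / T₀)
      (show 1 < 1 + w by rw [hw]; have := Real.sqrt_pos.2 (two_pos (α := ℝ)); linarith)
    refine ⟨j, 𝒞, (card_fiberPartition_parts_le P _).trans (le_trans ?_ hi), ?_⟩
    · exact (Finset.card_le_univ _).trans (by simp)
    · rw [div_lt_iff₀ hT₀] at hj
      simp only [T]
      linarith
  have hSmono : ∀ i i', i ≤ i' → S i ⊆ S i' := fun i i' h j ⟨𝒞, h1, h2⟩ => ⟨𝒞, h1.trans h, h2⟩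
  have hcard0 : ∀ i, sInf (S i) = 0 → 1 ≤ i → P.card ≤ i := by
    intro i h0 hi
    have hmem := Nat.sInf_mem (hSne i hi)
    rw [h0] at hmem
    obtain ⟨𝒞, h1, h2⟩ := hmem
    refine le_trans ?_ h1
    refine Finset.card_le_card_of_injOn 𝒞.part (fun p hp => 𝒞.part_mem.2 hp) ?_
    intro p hp q hq hpq
    by_contra hne
    have hp' : p ∈ P := hp
    have hq' : q ∈ P := hq
    have h3 := hc.dist_le X _ p q (𝒞.mem_part_self.2 hp') (hpq ▸ 𝒞.mem_part_self.2 hq')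
    have h4 := (cost_le_clusteringCost cost _ (𝒞.part_mem.2 hp')).trans h2
    have h5 := hsep p hp q hq hne
    have h6 := mul_le_mul_of_nonneg_left h4 hc.s_pos.le
    simp only [T, pow_zero, mul_one] at h6
    linarith
  refine ⟨⟨fun i => L (sInf (S i)), fun i hi _ => ?_, fun i hi _ => ?_⟩, fun i hi _ 𝒪 h𝒪 => ?_⟩
  · rcases hj : sInf (S i) with _ | j
    · exact (L 0).card_parts_le_card.trans (hcard0 i hj hi)
    · have hmem := Nat.sInf_mem (hSne i hi)
      rw [hj] at hmem
      obtain ⟨𝒞, h1, h2⟩ := hmem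
      exact (hLcard j).trans ((hmin _ 𝒞 h2).trans h1)
  · exact hLmono (Nat.sInf_le (hSmono i (i + 1) (Nat.le_succ i) (Nat.sInf_mem (hSne i hi))))
  · change clusteringCost cost (L (sInf (S i))) ≤ _
    rcases hj : sInf (S i) with _ | j
    · have h0 : clusteringCost cost (L 0) ≤ 0 := by
        refine clusteringCost_le cost _ le_rfl fun C hC => ?_
        obtain ⟨a, ha, rfl⟩ := mem_fiberPartition_parts.1 hC
        refine le_of_eq_of_le (congrArg (cost X) (?_ : _ = {a})) (hc.singleton_le X a)
        ext b
        simp only [Finset.mem_filter, Finset.mem_singleton]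
        exact ⟨fun h => h.2.symm, fun h => by rw [h]; exact ⟨ha, rfl⟩⟩
      have h1 := clusteringCost_nonneg hc 𝒪
      have := hc.A_nonneg
      exact h0.trans (by positivity)
    · refine (hLcost j).trans (mul_le_mul_of_nonneg_left ?_ ?_)
      · by_contra hlt
        have : sInf (S i) ≤ j := Nat.sInf_le ⟨𝒪, h𝒪.1, (not_le.1 hlt).le⟩
        omega
      · have := hc.A_nonneg
        positivity

/-! ### Existence of the price of hierarchy -/

open scoped Classical in
/-- If an instance has an `α`-approximation for every `α > ρ`, then it has a `ρ`-approximation: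
only finitely many hierarchies differ on the levels `1, …, |P|`. -/
theorem exists_isApproximation_of_forall_gt {cost : Objective} {X : Type} [MetricSpace X]
    {P : Finset X} {ρ : ℝ}
    (h : ∀ α, ρ < α → ∃ H : HierarchicalClustering P, H.IsApproximation cost α) :
    ∃ H : HierarchicalClustering P, H.IsApproximation cost ρ := by
  by_contra! hno
  let restr : HierarchicalClustering P → Fin (P.card + 1) → Finpartition P := fun H i => H.level i
  have key : ∀ g : Fin (P.card + 1) → Finpartition P, ∀ᶠ α in nhdsWithin ρ (Set.Ioi ρ),
      ∀ H : HierarchicalClustering P, restr H = g → ¬ H.IsApproximation cost α := by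
    intro g
    by_cases hg : ∃ H, restr H = g
    · obtain ⟨H, hH⟩ := hg
      have := hno H
      simp only [HierarchicalClustering.IsApproximation, not_forall, not_le] at this
      obtain ⟨i, hi, hiP, 𝒪, h𝒪, hlt⟩ := this
      have hcont : Filter.Tendsto (fun α => α * clusteringCost cost 𝒪)
          (nhdsWithin ρ (Set.Ioi ρ)) (nhds (ρ * clusteringCost cost 𝒪)) :=
        (Continuous.tendsto (by fun_prop) ρ).mono_left nhdsWithin_le_nhds
      refine (hcont.eventually_lt_const hlt).mono fun α hα H' hH' happ => ?_
      have heq : H'.level i = H.level i :=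
        congrFun (hH'.trans hH.symm) ⟨i, Nat.lt_succ_of_le hiP⟩
      have := happ i hi hiP 𝒪 h𝒪
      rw [heq] at this
      linarith
    · exact Filter.Eventually.of_forall fun α H hH => (hg ⟨H, hH⟩).elim
  obtain ⟨α, h1, h2⟩ := ((Filter.eventually_all.2 key).and self_mem_nhdsWithin).exists
  obtain ⟨H, hH⟩ := h α h2
  exact h1 _ H rfl hH

theorem IsTransportBounded.isApproximation_mono {cost : Objective} {s A : ℝ}
    (hc : IsTransportBounded cost s A) {X : Type} [MetricSpace X] {P : Finset X}
    {H : HierarchicalClustering P} {α α' : ℝ} (hα : α ≤ α') (h : H.IsApproximation cost α) :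
    H.IsApproximation cost α' := fun i hi hiP 𝒪 h𝒪 =>
  (h i hi hiP 𝒪 h𝒪).trans (mul_le_mul_of_nonneg_right hα (clusteringCost_nonneg hc 𝒪))

/-- An objective for which some factor can always be achieved has a price of hierarchy, and every
lower bound `b ≥ 1` on the achievable factors is a lower bound on the price. -/
theorem IsTransportBounded.exists_isPriceOfHierarchy {cost : Objective} {s A : ℝ}
    (hc : IsTransportBounded cost s A) {b : ℝ} (hb : 1 ≤ b)
    (hlow : ∀ α : ℝ, α < b → ∃ (X : Type) (_ : MetricSpace X) (P : Finset X),
      ¬ ∃ H : HierarchicalClustering P, H.IsApproximation cost α) :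
    ∃ ρ : ℝ, IsPriceOfHierarchy cost ρ ∧ b ≤ ρ := by
  let S : Set ℝ := {α | ∀ (X : Type) [MetricSpace X] (P : Finset X),
    ∃ H : HierarchicalClustering P, H.IsApproximation cost α}
  have hne : S.Nonempty := ⟨A * (3 + 2 * Real.sqrt 2), fun X _ P => hc.exists_isApproximation P⟩
  have hbd : ∀ α ∈ S, b ≤ α := fun α hα => by
    by_contra! hlt
    obtain ⟨X, _, P, hP⟩ := hlow α hlt
    exact hP (hα X P)
  have hbρ : b ≤ sInf S := le_csInf hne hbd
  refine ⟨sInf S, ⟨hb.trans hbρ, fun X _ P => ?_, fun α hα => ?_⟩, hbρ⟩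
  · refine exists_isApproximation_of_forall_gt fun α hα => ?_
    obtain ⟨α', h1, h2⟩ := exists_lt_of_csInf_lt hne hα
    obtain ⟨H, hH⟩ := h1 X P
    exact ⟨H, hc.isApproximation_mono h2.le hH⟩
  · have : α ∉ S := fun h => absurd (csInf_le ⟨b, hbd⟩ h) (not_le.2 hα)
    simp only [S, Set.mem_ofPred_eq, not_forall] at this
    exact this

/-! ### Shortest paths in weighted hypergraphs -/

namespace WeightedHypergraph

variable {V E : Type} {G : WeightedHypergraph V E}

theorem IsWalkLength.single {u v : V} (e : E) (hu : u ∈ G.verts e) (hv : v ∈ G.verts e) :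
    G.IsWalkLength u v (G.weight e) := by
  simpa using IsWalkLength.cons e hu hv (.nil v)

theorem IsWalkLength.append {u v w : V} {L L' : ℝ} (h : G.IsWalkLength u v L)
    (h' : G.IsWalkLength v w L') : G.IsWalkLength u w (L + L') := by
  induction h with
  | nil v => simpa using h'
  | cons e hu hv _ ih => rw [add_assoc]; exact .cons e hu hv (ih h')

theorem IsWalkLength.symm {u v : V} {L : ℝ} (h : G.IsWalkLength u v L) :
    G.IsWalkLength v u L := by
  induction h with
  | nil v => exact .nil v
  | cons e hu hv _ ih => rw [add_comm]; exact ih.append (.single e hv hu)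

/-- If the weights are positive multiples of `1 / 2`, then so are the lengths of walks; hence
shortest paths exist in a connected hypergraph, and their lengths form a metric. -/
theorem exists_isShortestPathMetric (hw : ∀ e, ∃ n : ℕ, 0 < n ∧ G.weight e = n / 2)
    (hconn : ∀ u v, ∃ L, G.IsWalkLength u v L) :
    ∃ m : MetricSpace V, G.IsShortestPathMetric m := by
  have hhalf : ∀ {u v L}, G.IsWalkLength u v L → ∃ n : ℕ, L = n / 2 := by
    intro u v L h
    induction h with
    | nil v => exact ⟨0, by simp⟩
    | cons e _ _ _ ih =>
      obtain ⟨n, hn⟩ := ih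
      obtain ⟨n', -, hn'⟩ := hw e
      exact ⟨n' + n, by rw [hn, hn']; push_cast; ring⟩
  have hleast : ∀ u v, ∃ L, IsLeast {L : ℝ | G.IsWalkLength u v L} L := by
    intro u v
    have hex : ∃ n : ℕ, G.IsWalkLength u v (n / 2) := by
      obtain ⟨L, hL⟩ := hconn u v
      obtain ⟨n, rfl⟩ := hhalf hL
      exact ⟨n, hL⟩
    classical
    refine ⟨(Nat.find hex : ℝ) / 2, Nat.find_spec hex, fun L hL => ?_⟩
    obtain ⟨n, rfl⟩ := hhalf hL
    have : (Nat.find hex : ℝ) ≤ n := by exact_mod_cast Nat.find_min' hex hL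
    linarith
  have hnonneg : ∀ {u v L}, G.IsWalkLength u v L → 0 ≤ L := fun h => by
    obtain ⟨n, rfl⟩ := hhalf h
    positivity
  choose D hD using hleast
  let m : MetricSpace V :=
    { dist := D
      dist_self := fun u => le_antisymm ((hD u u).2 (.nil u)) (hnonneg (hD u u).1)
      dist_comm := fun u v =>
        le_antisymm ((hD u v).2 (hD v u).1.symm) ((hD v u).2 (hD u v).1.symm)
      dist_triangle := fun u v w => (hD u w).2 ((hD u v).1.append (hD v w).1)
      eq_of_dist_eq_zero := fun {u v} h => by
        have h0 : G.IsWalkLength u v 0 := h ▸ (hD u v).1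
        have aux : ∀ {L}, G.IsWalkLength u v L → L = 0 → u = v := by
          intro L hL h0
          cases hL with
          | nil => rfl
          | cons e _ _ h' =>
            obtain ⟨n, hn, hn'⟩ := hw e
            have := hnonneg h'
            have : (0 : ℝ) < n := by exact_mod_cast hn
            linarith
        exact aux h0 rfl }
  exact ⟨m, hD⟩

end WeightedHypergraph

/-! ### Walks through the points of a layered hypergraph -/

section Layered

variable {Γ k : ℕ} {φ : LayerNumbering Γ}

theorem mem_line_self (j : Fin k) (X : LayerPoint Γ k) : X ∈ line φ j X :=
  ⟨fun _ _ => rfl, fun _ _ => rfl⟩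

theorem rowsBelow_congr {X Y : LayerPoint Γ k} {j : Fin k} (h : ∀ i < j, Y i = X i) :
    rowsBelow Y j = rowsBelow X j :=
  funext fun i => h ⟨i.1, i.2.trans j.2⟩ i.2

theorem rowsBelow_eq_of_mem_line {X Y : LayerPoint Γ k} {j : Fin k} (h : Y ∈ line φ j X) :
    rowsBelow Y j = rowsBelow X j :=
  rowsBelow_congr fun i hi => h.1 i hi.ne

theorem line_eq_of_mem_line {X Y : LayerPoint Γ k} {j : Fin k} (h : Y ∈ line φ j X) :
    line φ j Y = line φ j X := by
  ext Z
  constructor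
  · refine fun hZ => ⟨fun i hi => (hZ.1 i hi).trans (h.1 i hi), fun s hs => ?_⟩
    exact (hZ.2 s (by rwa [rowsBelow_eq_of_mem_line h])).trans (h.2 s hs)
  · refine fun hZ => ⟨fun i hi => (hZ.1 i hi).trans (h.1 i hi).symm, fun s hs => ?_⟩
    rw [rowsBelow_eq_of_mem_line h] at hs
    exact (hZ.2 s hs).trans (h.2 s hs).symm

theorem mem_line_comm {X Y : LayerPoint Γ k} {j : Fin k} (h : Y ∈ line φ j X) :
    X ∈ line φ j Y := by
  rw [line_eq_of_mem_line h]
  exact mem_line_self j X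

variable (φ) in
/-- `PointWalk φ X Y L`: there is a walk from `X` to `Y` of total weight `L` that uses only the
hyperedges `A`, and thus visits only points. -/
inductive PointWalk : LayerPoint Γ k → LayerPoint Γ k → ℕ → Prop
  | nil (X : LayerPoint Γ k) : PointWalk X X 0
  | cons {X Y Z : LayerPoint Γ k} {L : ℕ} (j : Fin k) (h : Y ∈ line φ j X)
      (hw : PointWalk Y Z L) : PointWalk X Z (j + 1 + L)

theorem PointWalk.append {X Y Z : LayerPoint Γ k} {L L' : ℕ} (h : PointWalk φ X Y L)
    (h' : PointWalk φ Y Z L') : PointWalk φ X Z (L + L') := by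
  induction h with
  | nil X => simpa using h'
  | cons j hY _ ih => rw [add_assoc]; exact .cons j hY (ih h')

theorem PointWalk.isWalkLength {X Y : LayerPoint Γ k} {L : ℕ} (h : PointWalk φ X Y L) :
    (layeredHypergraph k φ).IsWalkLength (Sum.inl X) (Sum.inl Y) L := by
  induction h with
  | nil X => simpa using WeightedHypergraph.IsWalkLength.nil (G := layeredHypergraph k φ) (Sum.inl X)
  | @cons X Y Z L j h _ ih =>
    have := WeightedHypergraph.IsWalkLength.cons (G := layeredHypergraph k φ)
      (Sum.inl ⟨j, line φ j X, X, rfl⟩) (u := Sum.inl X) (v := Sum.inl Y)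
      ⟨X, mem_line_self j X, rfl⟩ ⟨Y, h, rfl⟩ ih
    push_cast
    exact this

theorem mem_line_of_mem_lines {j : Fin k} (A : lines φ j) {X Y : LayerPoint Γ k} (hX : X ∈ A.1)
    (hY : Y ∈ A.1) : Y ∈ line φ j X := by
  obtain ⟨_, Z, rfl⟩ := A
  rw [line_eq_of_mem_line (show X ∈ line φ j Z from hX)]
  exact hY

/-- The additional vertices do not shorten any walk between points. -/
theorem exists_pointWalk_le {u w : LayeredVertex k φ} {L : ℝ}
    (h : (layeredHypergraph k φ).IsWalkLength u w L) {Y : LayerPoint Γ k} (hw : w = Sum.inl Y) :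
    (∀ X, u = Sum.inl X → ∃ L' : ℕ, PointWalk φ X Y L' ∧ (L' : ℝ) ≤ L) ∧
    ∀ a, u = Sum.inr a → ∀ X ∈ a.2.1,
      ∃ L' : ℕ, PointWalk φ X Y L' ∧ (L' : ℝ) ≤ L + ((a.1 : ℝ) + 1) / 2 := by
  induction h with
  | nil v =>
    subst hw
    refine ⟨fun X hX => ?_, fun a ha => by cases ha⟩
    obtain rfl := Sum.inl_injective hX
    exact ⟨0, .nil _, by simp⟩
  | @cons u v w L e hu hv _ ih =>
    obtain ⟨ih1, ih2⟩ := ih hw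
    rcases e with a | ⟨a, P⟩
    · obtain ⟨X, hX, rfl⟩ := hu
      obtain ⟨Z, hZ, rfl⟩ := hv
      refine ⟨fun X' hX' => ?_, fun b hb => by cases hb⟩
      obtain rfl := Sum.inl_injective hX'
      obtain ⟨L', h1, h2⟩ := ih1 Z rfl
      refine ⟨_, .cons a.1 (mem_line_of_mem_lines a.2 hX hZ) h1, ?_⟩
      push_cast
      exact add_le_add_right h2 _
    · have hpos : (0 : ℝ) ≤ (a.1 : ℝ) := by positivity
      have hweight : (layeredHypergraph k φ).weight (.inr ⟨a, P⟩) = ((a.1 : ℝ) + 1) / 2 := rfl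
      rw [hweight]
      rcases hu with rfl | rfl <;> rcases hv with rfl | rfl
      · refine ⟨fun X hX => ?_, fun b hb => by cases hb⟩
        obtain ⟨L', h1, h2⟩ := ih1 X hX
        exact ⟨L', h1, by linarith⟩
      · refine ⟨fun X hX => ?_, fun b hb => by cases hb⟩
        obtain rfl := Sum.inl_injective hX
        obtain ⟨L', h1, h2⟩ := ih2 a rfl _ P.2
        exact ⟨L', h1, by linarith⟩
      · refine ⟨fun X hX => (by cases hX), fun b hb X hX => ?_⟩
        obtain rfl := Sum.inr_injective hb
        obtain ⟨L', h1, h2⟩ := ih1 P.1 rfl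
        refine ⟨_, .cons a.1 (mem_line_of_mem_lines a.2 hX P.2) h1, ?_⟩
        push_cast
        linarith
      · refine ⟨fun X hX => (by cases hX), fun b hb X hX => ?_⟩
        obtain rfl := Sum.inr_injective hb
        obtain ⟨L', h1, h2⟩ := ih2 a rfl X hX
        exact ⟨L', h1, by linarith⟩

/-- Points that agree on all rows of index at least `m` are connected: the entry of row `m` at
position `s` can be changed after moving the rows below `m` to the point of number `s`. -/
theorem exists_pointWalk_of_agree (m : ℕ) : ∀ X Y : LayerPoint Γ k,
    (∀ i : Fin k, m ≤ i → Y i = X i) → ∃ L, PointWalk φ X Y L := by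
  classical
  induction m with
  | zero =>
    intro X Y h
    obtain rfl : Y = X := funext fun i => h i (Nat.zero_le _)
    exact ⟨0, .nil _⟩
  | succ m ih =>
    intro X Y h
    by_cases hm : m < k
    · let j : Fin k := ⟨m, hm⟩
      have step : ∀ S : Finset (Fin (layerCard Γ j)), ∀ Z : LayerPoint Γ k,
          (∀ i, j < i → Z i = X i) → (∀ s ∉ S, Z j s = X j s) → ∃ L, PointWalk φ X Z L := by
        intro S
        induction S using Finset.induction_on with
        | empty =>
          intro Z h1 h2
          refine ih X Z fun i hi => ?_
          rcases eq_or_lt_of_le (show j ≤ i from hi) with rfl | hlt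
          · exact funext fun s => h2 s (by simp)
          · exact h1 i hlt
        | @insert s S hs ihS =>
          intro Z h1 h2
          -- `W` has the rows of `Z` above `j`, and the point of number `s` below `j`.
          let W : LayerPoint Γ k :=
            fun i => if hi : i < j then ((φ j).symm s) ⟨i, hi⟩ else Z i
          have hWj : W j = Z j := dif_neg (lt_irrefl j)
          have hWbelow : φ j (rowsBelow W j) = s := by
            rw [← Equiv.eq_symm_apply]
            exact funext fun i => dif_pos (show (⟨i.1, _⟩ : Fin k) < j from i.2)
          let W' : LayerPoint Γ k := Function.update W j (Function.update (Z j) s (X j s))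
          have hWW' : W ∈ line φ j W' := by
            refine mem_line_comm ⟨fun i hi => Function.update_of_ne hi _ _, fun t ht => ?_⟩
            rw [hWbelow] at ht
            simp only [W', Function.update_self, Function.update_of_ne ht, hWj]
          obtain ⟨L₁, hL₁⟩ := ihS W'
            (fun i hi => by
              simp only [W', Function.update_of_ne hi.ne', W, dif_neg hi.not_gt, h1 i hi])
            (fun t ht => by
              simp only [W', Function.update_self]
              by_cases hts : t = s
              · subst hts; simp
              · rw [Function.update_of_ne hts]; exact h2 t (by simp [hts, ht]))
          obtain ⟨L₂, hL₂⟩ := ih W Z fun i hi => by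
            simp only [W, dif_neg (not_lt.2 (show j ≤ i from hi))]
          exact ⟨_, hL₁.append (.cons j hWW' hL₂)⟩
      exact step Finset.univ Y (fun i hi => h i hi) (fun s hs => absurd (Finset.mem_univ s) hs)
    · exact ih X Y fun i hi => absurd i.2 (by omega)

theorem exists_pointWalk (X Y : LayerPoint Γ k) : ∃ L, PointWalk φ X Y L :=
  exists_pointWalk_of_agree k X Y fun i hi => absurd i.2 (by omega)

theorem exists_isShortestPathMetric_layeredHypergraph (k : ℕ) (φ : LayerNumbering Γ) :
    ∃ m : MetricSpace (LayeredVertex k φ), (layeredHypergraph k φ).IsShortestPathMetric m := by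
  refine WeightedHypergraph.exists_isShortestPathMetric ?_ ?_
  · rintro (a | ⟨a, P⟩)
    · exact ⟨2 * (a.1 + 1), by omega, by simp [layeredHypergraph]⟩
    · exact ⟨a.1 + 1, by omega, by simp [layeredHypergraph]⟩
  · have hpt : ∀ u : LayeredVertex k φ, ∃ X L,
        (layeredHypergraph k φ).IsWalkLength u (Sum.inl X) L := by
      rintro (X | ⟨j, A, X, rfl⟩)
      · exact ⟨X, 0, .nil _⟩
      · exact ⟨X, _, .single (G := layeredHypergraph k φ)
          (Sum.inr ⟨⟨j, line φ j X, X, rfl⟩, X, mem_line_self j X⟩)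
          (Or.inr rfl) (Or.inl rfl)⟩
    intro u v
    obtain ⟨X, L, h⟩ := hpt u
    obtain ⟨Y, L', h'⟩ := hpt v
    obtain ⟨L'', h''⟩ := exists_pointWalk (φ := φ) X Y
    exact ⟨_, (h.append h''.isWalkLength).append h'.symm⟩

/-- The point with the rows of `X` below `j`, and the rows of `P` from `j` on. -/
def spliceRows (j : Fin k) (P X : LayerPoint Γ k) : LayerPoint Γ k :=
  fun i => if i < j then X i else P i

theorem spliceRows_eq_self {j : Fin k} {P X : LayerPoint Γ k} (h : ∀ i, j ≤ i → X i = P i) :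
    spliceRows j P X = X := by
  funext i
  by_cases hi : i < j
  · simp [spliceRows, hi]
  · simp [spliceRows, hi, h i (not_lt.1 hi)]

theorem spliceRows_congr {j : Fin k} {P X Y : LayerPoint Γ k}
    (h : rowsBelow X j = rowsBelow Y j) : spliceRows j P X = spliceRows j P Y := by
  funext i
  by_cases hi : i < j
  · simp only [spliceRows, if_pos hi]
    exact congrFun h ⟨i.1, hi⟩
  · simp [spliceRows, hi]

theorem PointWalk.splice {X Y : LayerPoint Γ k} {L : ℕ} (h : PointWalk φ X Y L) (j : Fin k)
    (P : LayerPoint Γ k) :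
    ∃ L' ≤ L, PointWalk φ (spliceRows j P X) (spliceRows j P Y) L' := by
  induction h with
  | nil X => exact ⟨0, le_rfl, .nil _⟩
  | @cons X Y Z L i hY _ ih =>
    obtain ⟨L', h1, h2⟩ := ih
    by_cases hij : i < j
    · refine ⟨i + 1 + L', by omega, .cons i ⟨fun l hl => ?_, fun s hs => ?_⟩ h2⟩
      · simp only [spliceRows, hY.1 l hl]
      · simp only [spliceRows, if_pos hij]
        refine hY.2 s fun h => hs ?_
        rw [h]
        refine congrArg (φ i) (rowsBelow_congr fun l hl => ?_)
        simp [spliceRows, hl.trans hij]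
    · refine ⟨L', by omega, ?_⟩
      have : rowsBelow X j = rowsBelow Y j :=
        (rowsBelow_congr fun l hl => hY.1 l (hl.trans_le (not_lt.1 hij)).ne).symm
      rwa [spliceRows_congr this]

/-- A walk that changes the entry of row `j` at position `s` uses a hyperedge of row `j` at a point
whose rows below `j` have the number `s`. -/
theorem PointWalk.exists_crossing {X Y : LayerPoint Γ k} {L : ℕ} (h : PointWalk φ X Y L)
    {j : Fin k} {s : Fin (layerCard Γ j)} (hs : X j s ≠ Y j s) :
    ∃ V V' L₁ L₂, rowsBelow V j = (φ j).symm s ∧ rowsBelow V' j = (φ j).symm s ∧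
      PointWalk φ X V L₁ ∧ PointWalk φ V' Y L₂ ∧ L₁ + (j + 1) + L₂ = L := by
  induction h with
  | nil X => exact absurd rfl hs
  | @cons X Y Z L i hY hw ih =>
    by_cases hXY : X j s = Y j s
    · rw [hXY] at hs
      obtain ⟨V, V', L₁, L₂, h1, h2, h3, h4, h5⟩ := ih hs
      exact ⟨V, V', i + 1 + L₁, L₂, h1, h2, .cons i hY h3, h4, by omega⟩
    · obtain rfl : i = j := by
        by_contra hij
        exact hXY (congrFun (hY.1 j (Ne.symm hij)).symm s)
      have h1 : rowsBelow X i = (φ i).symm s := by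
        rw [Equiv.eq_symm_apply]
        by_contra hne
        exact hXY (hY.2 s (Ne.symm hne)).symm
      exact ⟨X, Y, 0, L, h1, (rowsBelow_eq_of_mem_line hY).trans h1, .nil X, hw, by omega⟩

/-! ### Distances in a layered instance -/

variable (φ) in
/-- A point, as a vertex of the layered hypergraph. -/
abbrev pointVertex (X : LayerPoint Γ k) : LayeredVertex k φ := Sum.inl X

variable [m : MetricSpace (LayeredVertex k φ)]

theorem PointWalk.dist_le (hm : (layeredHypergraph k φ).IsShortestPathMetric m)
    {X Y : LayerPoint Γ k} {L : ℕ} (h : PointWalk φ X Y L) :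
    dist (pointVertex φ X) (pointVertex φ Y) ≤ L :=
  (hm _ _).2 h.isWalkLength

theorem exists_pointWalk_eq_dist (hm : (layeredHypergraph k φ).IsShortestPathMetric m)
    (X Y : LayerPoint Γ k) :
    ∃ L : ℕ, PointWalk φ X Y L ∧ (L : ℝ) = dist (pointVertex φ X) (pointVertex φ Y) := by
  obtain ⟨L, h1, h2⟩ := (exists_pointWalk_le (hm (Sum.inl X) (Sum.inl Y)).1 rfl).1 X rfl
  exact ⟨L, h1, h2.antisymm (h1.dist_le hm)⟩

theorem dist_spliceRows_le (hm : (layeredHypergraph k φ).IsShortestPathMetric m) (j : Fin k)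
    (P X Y : LayerPoint Γ k) :
    dist (pointVertex φ (spliceRows j P X)) (pointVertex φ (spliceRows j P Y)) ≤
      dist (pointVertex φ X) (pointVertex φ Y) := by
  obtain ⟨L, h1, h2⟩ := exists_pointWalk_eq_dist hm X Y
  obtain ⟨L', h3, h4⟩ := h1.splice j P
  rw [← h2]
  exact (h4.dist_le hm).trans (by exact_mod_cast h3)

theorem exists_crossing_dist_le (hm : (layeredHypergraph k φ).IsShortestPathMetric m)
    {X Y : LayerPoint Γ k} {j : Fin k} {s : Fin (layerCard Γ j)} (hs : X j s ≠ Y j s) :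
    ∃ V V', rowsBelow V j = (φ j).symm s ∧ rowsBelow V' j = (φ j).symm s ∧
      dist (pointVertex φ X) (pointVertex φ V) + ((j : ℝ) + 1) +
        dist (pointVertex φ V') (pointVertex φ Y) ≤ dist (pointVertex φ X) (pointVertex φ Y) := by
  obtain ⟨L, h1, h2⟩ := exists_pointWalk_eq_dist hm X Y
  obtain ⟨V, V', L₁, L₂, h3, h4, h5, h6, h7⟩ := h1.exists_crossing hs
  refine ⟨V, V', h3, h4, ?_⟩
  have h8 := h5.dist_le hm
  have h9 := h6.dist_le hm
  rw [← h2, ← h7]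
  push_cast
  linarith

theorem dist_le_of_mem_line (hm : (layeredHypergraph k φ).IsShortestPathMetric m)
    {X Y : LayerPoint Γ k} {j : Fin k} (h : Y ∈ line φ j X) :
    dist (pointVertex φ X) (pointVertex φ Y) ≤ (j : ℝ) + 1 := by
  have := (PointWalk.cons j h (.nil Y)).dist_le hm
  simpa using this

theorem dist_center_le (hm : (layeredHypergraph k φ).IsShortestPathMetric m)
    {X Y : LayerPoint Γ k} {j : Fin k} (h : Y ∈ line φ j X) :
    dist (Sum.inr ⟨j, line φ j X, X, rfl⟩ : LayeredVertex k φ) (pointVertex φ Y) ≤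
      ((j : ℝ) + 1) / 2 :=
  (hm _ _).2 (.single (G := layeredHypergraph k φ)
    (Sum.inr ⟨⟨j, line φ j X, X, rfl⟩, Y, h⟩) (Or.inr rfl) (Or.inl rfl))

end Layered

/-! ### Points whose clusters are large on every level -/

/-- Let `f 0, f 1, …` be coarser and coarser partitions, given by the values of functions. If `f t`
has so few classes that those with at most `c t` points cover at most the fraction `1 / (k + 1)`
of all points, for all `t < k`, then some non-empty set `B` meets each class in no point or in more
than `c t` points. It is what remains after the classes with few remaining points are removed, for
`t = 0, …, k - 1` in this order. -/
theorem exists_heavy_subset {α β : Type} [Fintype α] [DecidableEq α] [DecidableEq β] [Nonempty α]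
    (f : ℕ → α → β) (hf : ∀ t x y, f t x = f t y → f (t + 1) x = f (t + 1) y) (c : ℕ → ℕ) (k : ℕ)
    (hcard : ∀ t < k, (k + 1) * (c t * (Finset.univ.image (f t)).card) ≤ Fintype.card α) :
    ∃ B : Finset α, B.Nonempty ∧
      ∀ t < k, ∀ x ∈ B, c t < (B.filter fun y => f t y = f t x).card := by
  have hf' : ∀ {t t'}, t ≤ t' → ∀ {x y}, f t x = f t y → f t' x = f t' y := by
    intro t t' h x y hxy
    induction h with
    | refl => exact hxy
    | step _ ih => exact hf _ _ _ ih
  have key : ∀ k' ≤ k, ∃ B : Finset α, (k + 1) * Bᶜ.card ≤ k' * Fintype.card α ∧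
      ∀ t < k', ∀ x ∈ B, c t < (B.filter fun y => f t y = f t x).card := by
    intro k'
    induction k' with
    | zero => exact fun _ => ⟨Finset.univ, by simp, by simp⟩
    | succ k' ih =>
      intro hk'
      obtain ⟨B, h1, h2⟩ := ih (by omega)
      let B' := B.filter fun x => c k' < (B.filter fun y => f k' y = f k' x).card
      refine ⟨B', ?_, fun t ht x hx => ?_⟩
      · have hlight : (B \ B').card ≤ c k' * (Finset.univ.image (f k')).card := by
          refine (Finset.card_le_mul_card_image (f := f k') (B \ B') (c k') ?_).trans
            (Nat.mul_le_mul_left _ (Finset.card_le_card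
              (Finset.image_subset_image (Finset.subset_univ _))))
          intro b hb
          obtain ⟨x, hx, rfl⟩ := Finset.mem_image.1 hb
          simp only [B', Finset.mem_sdiff, Finset.mem_filter, not_and, not_lt] at hx
          refine (Finset.card_le_card fun y hy => ?_).trans (hx.2 hx.1)
          simp only [Finset.mem_filter, Finset.mem_sdiff] at hy ⊢
          exact ⟨hy.1.1, hy.2⟩
        have hcompl : B'ᶜ.card ≤ Bᶜ.card + (B \ B').card := by
          refine (Finset.card_le_card fun x hx => ?_).trans (Finset.card_union_le _ _)
          simp only [Finset.mem_union, Finset.mem_compl, Finset.mem_sdiff] at hx ⊢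
          tauto
        have h3 := hcard k' (by omega)
        calc (k + 1) * B'ᶜ.card ≤ (k + 1) * (Bᶜ.card + (B \ B').card) :=
              Nat.mul_le_mul_left _ hcompl
          _ = (k + 1) * Bᶜ.card + (k + 1) * (B \ B').card := by ring
          _ ≤ k' * Fintype.card α + Fintype.card α :=
              add_le_add h1 ((Nat.mul_le_mul_left _ hlight).trans h3)
          _ = (k' + 1) * Fintype.card α := by ring
      · -- The removed classes are unions of earlier classes, which are thus removed as a whole.
        obtain ⟨hxB, hxc⟩ := Finset.mem_filter.1 hx
        have heq : (B'.filter fun y => f t y = f t x) = B.filter fun y => f t y = f t x := by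
          ext y
          simp only [B', Finset.mem_filter]
          refine ⟨fun h => ⟨h.1.1, h.2⟩, fun h => ⟨⟨h.1, ?_⟩, h.2⟩⟩
          rw [hf' (Nat.lt_succ_iff.1 ht) h.2]
          exact hxc
        rw [heq]
        rcases Nat.lt_succ_iff_lt_or_eq.1 ht with h | rfl
        · exact h2 t h x hxB
        · exact hxc
  obtain ⟨B, h1, h2⟩ := key k le_rfl
  refine ⟨B, ?_, h2⟩
  rw [Finset.nonempty_iff_ne_empty]
  rintro rfl
  rw [Finset.compl_empty, Finset.card_univ, add_mul, one_mul] at h1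
  have := Fintype.card_pos (α := α)
  omega

/-! ### The recursion for the growth of clusters -/

/-- Read `Q t x r` as: the cluster of `x` at time `t` has eccentricity at least `r`. If every linear
lower bound `c * t - d` on the eccentricities can be improved by `hstep`, then it can be improved
to one of slope `1 + c / (α - κ * c)`. Below the critical value of `α`, at which the discriminant of
the fixed point equation changes its sign, the slope grows by at least a fixed amount, and thus
exceeds `α / κ` after finitely many steps, which is absurd for large `k`. -/
theorem exists_forall_ge_growth_absurd {α κ : ℝ} (hα : 0 < α) (hκ : 0 < κ)
    (hdisc : (α + κ - 1) ^ 2 < 4 * κ * α) :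
    ∃ k₀ : ℕ, ∀ k ≥ k₀, ∀ (ι : Type) [Nonempty ι] (Q : ℕ → ι → ℝ → Prop),
      (∀ t x r r', r' ≤ r → Q t x r → Q t x r') → (∀ t x, Q t x 0) →
      (∀ e : ℕ → ℝ, (∀ t ≤ k, ∀ x, Q t x (e t)) → ∀ t < k, ∀ x, ∃ s ≤ t,
        (t + 1 : ℝ) + κ * e s ≤ α * (s + 1) ∧ Q (t + 1) x (t + 1 + e s)) → False := by
  let δ : ℝ := (α - (α + κ - 1) ^ 2 / (4 * κ)) / α
  have hδ : 0 < δ := by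
    have : (α + κ - 1) ^ 2 / (4 * κ) < α := by
      rw [div_lt_iff₀ (by positivity)]
      linarith
    exact div_pos (by linarith) hα
  have himp : ∀ c : ℝ, κ * c < α → 0 ≤ c → c + δ ≤ 1 + c / (α - κ * c) := by
    intro c hc hc0
    have hden : 0 < α - κ * c := by linarith
    have hη : 0 < δ * α := by positivity
    have hδα : δ * α = α - (α + κ - 1) ^ 2 / (4 * κ) := div_mul_cancel₀ _ hα.ne'
    -- Completing the square.
    have hnum : δ * α ≤ κ * c ^ 2 - (α + κ - 1) * c + α := by
      rw [hδα]
      have : κ * c ^ 2 - (α + κ - 1) * c + (α + κ - 1) ^ 2 / (4 * κ) =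
          κ * (c - (α + κ - 1) / (2 * κ)) ^ 2 := by
        field_simp
        ring
      have : 0 ≤ κ * (c - (α + κ - 1) / (2 * κ)) ^ 2 := by positivity
      linarith
    have : (c + δ - 1) * (α - κ * c) ≤ c := by
      have : 0 ≤ δ * (κ * c) := by positivity
      nlinarith
    have := (le_div_iff₀ hden).2 this
    linarith
  obtain ⟨n₀, hn₀⟩ := Archimedean.arch (α / κ) hδ
  have hex : ∃ n : ℕ, α ≤ κ * (n * δ) := ⟨n₀, by
    rw [nsmul_eq_mul, div_le_iff₀ hκ] at hn₀
    linarith⟩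
  classical
  let N := Nat.find hex
  let d : ℕ → ℝ := fun n =>
    Nat.rec 0 (fun n d => d + (n * δ) * (κ * d + α) / (α - κ * (n * δ))) n
  obtain ⟨k₀, hk₀⟩ := exists_nat_gt (α + κ * d N)
  refine ⟨k₀ + 1, fun k hk ι _ Q hmono h0 hstep => ?_⟩
  have key : ∀ n ≤ N, 0 ≤ d n ∧ ∀ t ≤ k, ∀ x, Q t x ((n * δ) * t - d n) := by
    intro n
    induction n with
    | zero => exact fun _ => ⟨le_rfl, fun t _ x => by simpa [d] using h0 t x⟩
    | succ n ih =>
      intro hn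
      obtain ⟨hd, hQ⟩ := ih (by omega)
      have hc : κ * (n * δ) < α := not_le.1 (Nat.find_min hex (show n < N from hn))
      have hc0 : 0 ≤ n * δ := by positivity
      have hi := himp _ hc hc0
      set c : ℝ := n * δ with hcdef
      have hden : 0 < α - κ * c := by linarith
      have hdsucc : d (n + 1) = d n + c * (κ * d n + α) / (α - κ * c) := rfl
      have hfrac : 0 ≤ c * (κ * d n + α) / (α - κ * c) := by positivity
      have hcast : ((n + 1 : ℕ) : ℝ) * δ = c + δ := by push_cast; ring
      rw [hdsucc, hcast]
      refine ⟨by linarith, fun t ht x => ?_⟩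
      rcases t with _ | t
      · refine hmono _ _ _ _ ?_ (h0 0 x)
        simp only [Nat.cast_zero, mul_zero]
        linarith
      · obtain ⟨s, -, h1, h2⟩ := hstep (fun t => c * t - d n) hQ t (by omega) x
        refine hmono _ _ _ _ ?_ h2
        have h3 : ((t : ℝ) + 1 - (κ * d n + α)) / (α - κ * c) ≤ s := by
          rw [div_le_iff₀ hden]
          linarith
        have h4 := mul_le_mul_of_nonneg_left h3 hc0
        have h5 : c * (((t : ℝ) + 1 - (κ * d n + α)) / (α - κ * c)) =
            c / (α - κ * c) * (t + 1) - c * (κ * d n + α) / (α - κ * c) := by ring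
        have h6 := mul_le_mul_of_nonneg_right hi (show (0 : ℝ) ≤ (t : ℝ) + 1 by positivity)
        push_cast
        linarith
  obtain ⟨hd, hQ⟩ := key N le_rfl
  obtain ⟨s, -, h1, -⟩ := hstep _ hQ (k - 1) (by omega) (Classical.arbitrary ι)
  have h2 : α ≤ κ * (N * δ) := Nat.find_spec hex
  have h3 : ((k - 1 : ℕ) : ℝ) + 1 = k := by
    rw [Nat.cast_sub (by omega)]
    simp
  have h4 : (k₀ : ℝ) + 1 ≤ k := by exact_mod_cast hk
  have h5 := mul_le_mul_of_nonneg_right h2 (Nat.cast_nonneg (α := ℝ) s)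
  rw [h3] at h1
  linarith

/-! ### Eccentricities of clusters in a layered instance -/

section Layered

variable {Γ k : ℕ} {φ : LayerNumbering Γ} [m : MetricSpace (LayeredVertex k φ)]

/-- The geometric step of the lower bound. The values of `g 0, g 1, …` are coarser and coarser
clusterings, and the clusters that meet `B` are large in `B`. If `e s` is a lower bound on the
eccentricity, with respect to any point, of the clusters at time `s`, then every cluster at time
`t + 1` contains one at some time `s + 1 ≤ t + 1` of diameter at least `t + 1 + 2 * e s` and
eccentricity at least `t + 1 + e s`.

Indeed, a large cluster varies in some row `j ≥ t`. Let `j` be the last such row, and `s + 1` the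
first time at which the points of some subcluster vary in row `j`, say in the entry at position `p`
for two of its points. On the subclusters of these two at time `s` the rows from `j` on are
constant. Hence each path that changes the entry leads from one of the subclusters to the place
numbered `p`, which costs `e s`, and through a hyperedge of row `j`. -/
theorem exists_growth_step (hm : (layeredHypergraph k φ).IsShortestPathMetric m) {S : Type}
    [DecidableEq S] {g : ℕ → LayerPoint Γ k → S} (hg0 : Function.Injective (g 0))
    (hg : ∀ t x y, g t x = g t y → g (t + 1) x = g (t + 1) y) {B : Finset (LayerPoint Γ k)}
    (hB : ∀ t < k, ∀ x ∈ B, layerCard Γ t < (B.filter fun y => g (t + 1) y = g (t + 1) x).card)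
    {e : ℕ → ℝ} (he : ∀ t ≤ k, ∀ x ∈ B, ∀ W, ∃ y ∈ B, g t y = g t x ∧
      e t ≤ dist (pointVertex φ y) (pointVertex φ W))
    {t : ℕ} (ht : t < k) {x : LayerPoint Γ k} (hx : x ∈ B) :
    ∃ s ≤ t, ∃ z ∈ B, g (t + 1) z = g (t + 1) x ∧
      (∃ y, g (s + 1) y = g (s + 1) z ∧ ∃ y', g (s + 1) y' = g (s + 1) z ∧
        (t + 1 : ℝ) + 2 * e s ≤ dist (pointVertex φ y) (pointVertex φ y')) ∧
      ∀ W, ∃ y ∈ B, g (s + 1) y = g (s + 1) z ∧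
        (t + 1 : ℝ) + e s ≤ dist (pointVertex φ y) (pointVertex φ W) := by
  classical
  have hg' : ∀ {t t'}, t ≤ t' → ∀ {x y}, g t x = g t y → g t' x = g t' y := by
    intro t t' h x y hxy
    induction h with
    | refl => exact hxy
    | step _ ih => exact hg _ _ _ ih
  let varies : Fin k → Prop := fun i =>
    ∃ y ∈ B, ∃ y' ∈ B, g (t + 1) y = g (t + 1) x ∧ g (t + 1) y' = g (t + 1) x ∧ y i ≠ y' i
  obtain ⟨i₀, hi₀, hvar₀⟩ : ∃ i₀ : Fin k, t ≤ i₀ ∧ varies i₀ := by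
    obtain ⟨y, hy, y', hy', hne, heq⟩ := Finset.exists_ne_map_eq_of_card_lt_of_maps_to
      (t := (Finset.univ : Finset (LayerPoint Γ t)))
      (by rw [Finset.card_univ, card_layerPoint]; exact hB t ht x hx)
      (f := fun y => rowsBelow y ⟨t, ht⟩) (fun _ _ => Finset.mem_coe.2 (Finset.mem_univ _))
    obtain ⟨hyB, hyx⟩ := Finset.mem_filter.1 hy
    obtain ⟨hyB', hyx'⟩ := Finset.mem_filter.1 hy'
    obtain ⟨i, hi⟩ := Function.ne_iff.1 hne
    refine ⟨i, ?_, y, hyB, y', hyB', hyx, hyx', hi⟩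
    by_contra! hlt
    exact hi (congrFun heq ⟨i.1, hlt⟩)
  obtain ⟨j, hj, hjmax⟩ := Finset.exists_max_image (Finset.univ.filter varies) id
    ⟨i₀, by simpa using hvar₀⟩
  have hjvar : varies j := (Finset.mem_filter.1 hj).2
  have hjt : t ≤ j := hi₀.trans (hjmax i₀ (by simpa using hvar₀))
  have hjtR : (t : ℝ) ≤ (j : ℝ) := by exact_mod_cast hjt
  let splits : ℕ → Prop := fun s => ∃ y ∈ B, ∃ y' ∈ B, g (t + 1) y = g (t + 1) x ∧
    g (t + 1) y' = g (t + 1) x ∧ g s y = g s y' ∧ y j ≠ y' j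
  have hex : ∃ s, splits s := by
    obtain ⟨y, hy, y', hy', h1, h2, h3⟩ := hjvar
    exact ⟨t + 1, y, hy, y', hy', h1, h2, h1.trans h2.symm, h3⟩
  have hle : Nat.find hex ≤ t + 1 := Nat.find_min' hex (by
    obtain ⟨y, hy, y', hy', h1, h2, h3⟩ := hjvar
    exact ⟨y, hy, y', hy', h1, h2, h1.trans h2.symm, h3⟩)
  obtain ⟨P, hP, Q, hQ, hPx, hQx, hPQ, hne⟩ := Nat.find_spec hex
  have hlast : ∀ s < Nat.find hex, ¬ splits s := fun s hs => Nat.find_min hex hs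
  rcases hs : Nat.find hex with _ | s
  · rw [hs] at hPQ
    exact absurd (congrFun (hg0 hPQ) j) hne
  rw [hs] at hPQ hle hlast
  have hst : s ≤ t := by omega
  have hagree : ∀ R ∈ B, g (t + 1) R = g (t + 1) x → ∀ R' ∈ B, g s R' = g s R →
      ∀ i, j ≤ i → R' i = R i := by
    intro R hR hRx R' hR' hRR' i hi
    by_contra hcon
    have hR'x := (hg' (by omega : s ≤ t + 1) hRR').trans hRx
    rcases eq_or_lt_of_le hi with rfl | hlt
    · exact hlast s (by omega) ⟨R', hR', R, hR, hR'x, hRx, hRR', hcon⟩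
    · exact absurd (hjmax i (by simpa using ⟨R', hR', R, hR, hR'x, hRx, hcon⟩)) (not_le.2 hlt)
  obtain ⟨p, hp⟩ := Function.ne_iff.1 hne
  -- The place numbered `p`, with the rows from `j` on filled up as in `R`.
  let place : LayerPoint Γ k → LayerPoint Γ k := fun R i =>
    if h : i < j then (φ j).symm p ⟨i.1, h⟩ else R i
  have hplace : ∀ R V : LayerPoint Γ k, rowsBelow V j = (φ j).symm p →
      spliceRows j R V = place R := by
    intro R V hV
    funext i
    by_cases hi : i < j
    · simp only [spliceRows, place, if_pos hi, dif_pos hi, ← hV]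
      rfl
    · simp only [spliceRows, place, if_neg hi, dif_neg hi]
  have hfar : ∀ R ∈ B, g (t + 1) R = g (t + 1) x → ∃ R' ∈ B, g s R' = g s R ∧ R' j = R j ∧
      ∀ V : LayerPoint Γ k, rowsBelow V j = (φ j).symm p →
        e s ≤ dist (pointVertex φ R') (pointVertex φ V) := by
    intro R hR hRx
    obtain ⟨R', hR', h1, h2⟩ := he s (by omega) R hR (place R)
    have h3 := hagree R hR hRx R' hR' h1
    refine ⟨R', hR', h1, h3 j le_rfl, fun V hV => h2.trans ?_⟩
    have h4 := dist_spliceRows_le hm j R R' V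
    rwa [spliceRows_eq_self h3, hplace R V hV] at h4
  obtain ⟨P', hP', hgP, hPj, hPfar⟩ := hfar P hP hPx
  obtain ⟨Q', hQ', hgQ, hQj, hQfar⟩ := hfar Q hQ hQx
  have hgP' : g (s + 1) P' = g (s + 1) P := hg _ _ _ hgP
  have hgQ' : g (s + 1) Q' = g (s + 1) P := (hg _ _ _ hgQ).trans hPQ.symm
  refine ⟨s, hst, P, hP, hPx, ⟨P', hgP', Q', hgQ', ?_⟩, fun W => ?_⟩
  · have hp' : P' j p ≠ Q' j p := by rwa [hPj, hQj]
    obtain ⟨V, V', h1, h2, h3⟩ := exists_crossing_dist_le hm hp'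
    have h4 := hPfar V h1
    have h5 := hQfar V' h2
    rw [dist_comm] at h5
    linarith
  · have hcases : P' j p ≠ W j p ∨ Q' j p ≠ W j p := by
      rw [hPj, hQj]
      by_contra! h
      exact hp (h.1.trans h.2.symm)
    rcases hcases with h | h
    · obtain ⟨V, V', h1, -, h3⟩ := exists_crossing_dist_le hm h
      refine ⟨P', hP', hgP', ?_⟩
      have := hPfar V h1
      have := dist_nonneg (x := pointVertex φ V') (y := pointVertex φ W)
      linarith
    · obtain ⟨V, V', h1, -, h3⟩ := exists_crossing_dist_le hm h
      refine ⟨Q', hQ', hgQ', ?_⟩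
      have := hQfar V h1
      have := dist_nonneg (x := pointVertex φ V') (y := pointVertex φ W)
      linarith

end Layered

/-! ### Clusters of a hierarchical clustering -/

section Clusters

variable {X : Type} {P : Finset X}

open scoped Classical in
/-- The cluster of `p` on level `i`. -/
noncomputable def HierarchicalClustering.cluster (H : HierarchicalClustering P) (i : ℕ) (p : X) :
    Finset X :=
  (H.level i).part p

open scoped Classical in
theorem HierarchicalClustering.mem_cluster_self (H : HierarchicalClustering P) (i : ℕ) {p : X}
    (hp : p ∈ P) : p ∈ H.cluster i p :=
  (H.level i).mem_part_self.2 hp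

open scoped Classical in
theorem HierarchicalClustering.cluster_subset (H : HierarchicalClustering P) (i : ℕ) (p : X) :
    H.cluster i p ⊆ P :=
  (H.level i).part_subset p

open scoped Classical in
theorem HierarchicalClustering.card_image_cluster_le [DecidableEq (Finset X)]
    (H : HierarchicalClustering P) {i : ℕ} (hi : 1 ≤ i) (hiP : i ≤ P.card) :
    (P.image (H.cluster i)).card ≤ i := by
  refine (Finset.card_le_card fun C hC => ?_).trans (H.card_level i hi hiP)
  obtain ⟨p, hp, rfl⟩ := Finset.mem_image.1 hC
  exact (H.level i).part_mem.2 hp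

open scoped Classical in
theorem HierarchicalClustering.level_le_level (H : HierarchicalClustering P) {a b : ℕ}
    (ha : 1 ≤ a) (hab : a ≤ b) (hb : b ≤ P.card) : H.level b ≤ H.level a := by
  induction hab with
  | refl => exact le_rfl
  | @step b h ih => exact (H.refines b (ha.trans h) hb).trans (ih (Nat.le_of_succ_le hb))

open scoped Classical in
theorem HierarchicalClustering.cluster_eq_cluster_of_le (H : HierarchicalClustering P) {a b : ℕ}
    (ha : 1 ≤ a) (hab : a ≤ b) (hb : b ≤ P.card) {p q : X} (hp : p ∈ P) (hq : q ∈ P)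
    (hpq : H.cluster b p = H.cluster b q) : H.cluster a p = H.cluster a q := by
  obtain ⟨D, hD, hCD⟩ := H.level_le_level ha hab hb ((H.level b).part_mem.2 hp)
  have hqD : q ∈ D := hCD (show q ∈ H.cluster b p from hpq ▸ H.mem_cluster_self b hq)
  exact ((H.level a).part_eq_of_mem hD (hCD (H.mem_cluster_self b hp))).trans
    ((H.level a).part_eq_of_mem hD hqD).symm

open scoped Classical in
theorem exists_isOptimalClustering [MetricSpace X] (cost : Objective) (P : Finset X)
    {i : ℕ} (hi : 1 ≤ i) : ∃ 𝒪 : Finpartition P, IsOptimalClustering cost i 𝒪 := by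
  have hone : (fiberPartition P fun _ => ()).parts.card ≤ i :=
    (card_fiberPartition_parts_le P _).trans
      (((Finset.card_le_univ _).trans (by simp)).trans hi)
  obtain ⟨𝒪, h1, h2⟩ := Set.exists_min_image {𝒞 : Finpartition P | 𝒞.parts.card ≤ i}
    (fun 𝒞 => clusteringCost cost 𝒞) (Set.toFinite _) ⟨_, hone⟩
  exact ⟨𝒪, h1, h2⟩

open scoped Classical in
/-- On level `i`, the clusters of an `α`-approximation cost at most `α` times as much as the fibers
of any function with at most `i` values. -/
theorem HierarchicalClustering.IsApproximation.cost_cluster_le [MetricSpace X]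
    {H : HierarchicalClustering P} {cost : Objective} {α : ℝ} (h : H.IsApproximation cost α)
    (hα : 0 ≤ α) {i : ℕ} (hi : 1 ≤ i) (hiP : i ≤ P.card) {Y : Type} (f : X → Y)
    (hf : (P.image f).card ≤ i) {r : ℝ} (hr : 0 ≤ r)
    (hcost : ∀ a ∈ P, ∀ C : Finset X, (∀ v, v ∈ C ↔ v ∈ P ∧ f a = f v) → cost X C ≤ r)
    {p : X} (hp : p ∈ P) : cost X (H.cluster i p) ≤ α * r := by
  obtain ⟨𝒪, h𝒪⟩ := exists_isOptimalClustering cost P hi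
  have h1 : clusteringCost cost 𝒪 ≤ r := by
    refine (h𝒪.2 (fiberPartition P f)
      ((card_fiberPartition_parts_le P f).trans hf)).trans
      (clusteringCost_le cost _ hr fun C hC => ?_)
    obtain ⟨a, ha, rfl⟩ := mem_fiberPartition_parts.1 hC
    exact hcost a ha _ fun v => Finset.mem_filter
  exact (cost_le_clusteringCost cost _ ((H.level i).part_mem.2 hp)).trans
    ((h i hi hiP 𝒪 h𝒪).trans (mul_le_mul_of_nonneg_left h1 hα))

end Clusters

/-! ### The clusterings of a layered instance into lines -/

theorem layerCard_pos {Γ : ℕ} (hΓ : 0 < Γ) (ℓ : ℕ) : 0 < layerCard Γ ℓ := by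
  induction ℓ with
  | zero => exact one_pos
  | succ ℓ ih => rw [layerCard]; positivity

theorem layerCard_mono {Γ : ℕ} (hΓ : 0 < Γ) : Monotone (layerCard Γ) :=
  monotone_nat_of_le_succ fun ℓ =>
    Nat.le_mul_of_pos_right _ (pow_pos (Nat.mul_pos hΓ (layerCard_pos hΓ ℓ)) _)

section Layered

variable {Γ k : ℕ} {φ : LayerNumbering Γ}

theorem card_layeredPoints : (layeredPoints k φ).card = layerCard Γ k := by
  rw [layeredPoints, Finset.card_map, Finset.card_univ, card_layerPoint]

theorem pointVertex_mem_layeredPoints (X : LayerPoint Γ k) :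
    pointVertex φ X ∈ layeredPoints k φ :=
  Finset.mem_map_of_mem _ (Finset.mem_univ X)

theorem exists_of_mem_layeredPoints {v : LayeredVertex k φ} (hv : v ∈ layeredPoints k φ) :
    ∃ X, v = pointVertex φ X := by
  obtain ⟨X, -, rfl⟩ := Finset.mem_map.1 hv
  exact ⟨X, rfl⟩

variable (φ) in
/-- The line of row `j` through a point. The value at the other vertices is irrelevant. -/
def lineOf (j : Fin k) : LayeredVertex k φ → Set (LayerPoint Γ k) :=
  Sum.elim (line φ j) fun _ => ∅

theorem mem_layeredPoints_and_lineOf_eq {j : Fin k} {X : LayerPoint Γ k} {v : LayeredVertex k φ} :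
    v ∈ layeredPoints k φ ∧ lineOf φ j (pointVertex φ X) = lineOf φ j v ↔
      ∃ Y ∈ line φ j X, v = pointVertex φ Y := by
  constructor
  · rintro ⟨hv, h⟩
    obtain ⟨Y, rfl⟩ := exists_of_mem_layeredPoints hv
    have h' : line φ j X = line φ j Y := h
    exact ⟨Y, h' ▸ mem_line_self j Y, rfl⟩
  · rintro ⟨Y, hY, rfl⟩
    exact ⟨pointVertex_mem_layeredPoints Y, (line_eq_of_mem_line hY).symm⟩

open scoped Classical in
theorem mul_card_image_lineOf_le (j : Fin k) :
    Γ * layerCard Γ j * ((layeredPoints k φ).image (lineOf φ j)).card ≤ layerCard Γ k := by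
  have h1 : ((layeredPoints k φ).image (lineOf φ j)).card ≤
      (Finset.univ.image (line φ j)).card := by
    refine Finset.card_le_card fun A hA => ?_
    obtain ⟨v, hv, rfl⟩ := Finset.mem_image.1 hA
    obtain ⟨X, rfl⟩ := exists_of_mem_layeredPoints hv
    exact Finset.mem_image_of_mem _ (Finset.mem_univ X)
  refine (Nat.mul_le_mul_left _ h1).trans ?_
  rw [← card_layerPoint Γ k, ← Finset.card_univ (α := LayerPoint Γ k)]
  refine Finset.mul_card_image_le_card _ _ fun A hA => ?_
  obtain ⟨X, -, rfl⟩ := Finset.mem_image.1 hA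
  -- The points of a line are obtained by inserting all possible values in one entry.
  let ins : Fin (Γ * layerCard Γ j) → LayerPoint Γ k := fun a =>
    Function.update X j (Function.update (X j) (φ j (rowsBelow X j)) a)
  have hins : Function.Injective ins := fun a b hab => by
    have := congrFun (congrFun hab j) (φ j (rowsBelow X j))
    simpa [ins] using this
  calc Γ * layerCard Γ j = (Finset.univ.image ins).card := by
        rw [Finset.card_image_of_injective _ hins, Finset.card_univ, Fintype.card_fin]
    _ ≤ _ := by
        refine Finset.card_le_card fun Y hY => ?_
        obtain ⟨a, -, rfl⟩ := Finset.mem_image.1 hY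
        refine Finset.mem_filter.2 ⟨Finset.mem_univ _, line_eq_of_mem_line ⟨fun i hi => ?_,
          fun s hs => ?_⟩⟩
        · exact Function.update_of_ne hi _ _
        · simp only [ins, Function.update_self, Function.update_of_ne hs]

end Layered

/-! ### Lower bounds on the approximation factor -/

open scoped Classical in
/-- The lower bound for an objective under which the lines of row `j` cost at most `lam * (j + 1)`,
and a cluster of diameter at least `r + 2 * e` and eccentricity at least `r + e` costs at least
`lam * (r + κ * e)`. The factor `α` has to be such that the growth of the clusters is absurd for
the parameter `k`. -/
theorem not_isApproximation_of_growth_absurd {k : ℕ} {φ : LayerNumbering (k + 1)}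
    [m : MetricSpace (LayeredVertex k φ)] (hm : (layeredHypergraph k φ).IsShortestPathMetric m)
    {cost : Objective} {lam κ α : ℝ} (hlam : 0 < lam) (hα : 0 < α)
    (hline : ∀ (j : Fin k) (X : LayerPoint (k + 1) k) (C : Finset (LayeredVertex k φ)),
      (∀ v, v ∈ C ↔ ∃ Y ∈ line φ j X, v = pointVertex φ Y) → cost _ C ≤ lam * ((j : ℝ) + 1))
    (hgrow : ∀ C : Finset (LayeredVertex k φ), C.Nonempty → C ⊆ layeredPoints k φ → ∀ r e : ℝ,
      (∃ v ∈ C, ∃ w ∈ C, r + 2 * e ≤ dist v w) →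
      (∀ W, ∃ v ∈ C, r + e ≤ dist v (pointVertex φ W)) → lam * (r + κ * e) ≤ cost _ C)
    (habs : ∀ (ι : Type) [Nonempty ι] (Q : ℕ → ι → ℝ → Prop),
      (∀ t x r r', r' ≤ r → Q t x r → Q t x r') → (∀ t x, Q t x 0) →
      (∀ e : ℕ → ℝ, (∀ t ≤ k, ∀ x, Q t x (e t)) → ∀ t < k, ∀ x, ∃ s ≤ t,
        (t + 1 : ℝ) + κ * e s ≤ α * (s + 1) ∧ Q (t + 1) x (t + 1 + e s)) → False)
    (H : HierarchicalClustering (layeredPoints k φ)) : ¬ H.IsApproximation cost α := by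
  intro happ
  have hΓ : 0 < k + 1 := Nat.succ_pos k
  have hNpos := layerCard_pos hΓ
  have : Nonempty (LayerPoint (k + 1) k) :=
    Fintype.card_pos_iff.1 (by rw [card_layerPoint]; exact hNpos k)
  -- For `t < k`, there are at most `M t` lines of row `t`.
  let M : ℕ → ℕ := fun t => max 1 (layerCard (k + 1) k / ((k + 1) * layerCard (k + 1) t))
  have hM1 : ∀ t, 1 ≤ M t := fun t => le_max_left _ _
  have hMle : ∀ t, M t ≤ (layeredPoints k φ).card := fun t => by
    rw [card_layeredPoints]
    exact max_le (hNpos k) (Nat.div_le_self _ _)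
  have hManti : ∀ t, M (t + 1) ≤ M t := fun t =>
    max_le_max le_rfl (Nat.div_le_div_left
      (Nat.mul_le_mul_left _ (layerCard_mono hΓ (Nat.le_succ t)))
      (Nat.mul_pos hΓ (hNpos t)))
  have hlines : ∀ j : Fin k, ((layeredPoints k φ).image (lineOf φ j)).card ≤
      layerCard (k + 1) k / ((k + 1) * layerCard (k + 1) j) := fun j => by
    rw [Nat.le_div_iff_mul_le (Nat.mul_pos hΓ (hNpos j)), mul_comm]
    exact mul_card_image_lineOf_le j
  have hMeq : ∀ t < k, M t = layerCard (k + 1) k / ((k + 1) * layerCard (k + 1) t) := by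
    intro t ht
    refine max_eq_right (le_trans ?_ (hlines ⟨t, ht⟩))
    exact Finset.card_pos.2 ⟨_, Finset.mem_image_of_mem _
      (pointVertex_mem_layeredPoints (Classical.arbitrary _))⟩
  let g : ℕ → LayerPoint (k + 1) k → Finset (LayeredVertex k φ) := fun t X =>
    Nat.casesOn t {pointVertex φ X} fun t => H.cluster (M t) (pointVertex φ X)
  have hg0 : Function.Injective (g 0) := fun X Y h =>
    Sum.inl_injective (Finset.singleton_injective h)
  have hg : ∀ t X Y, g t X = g t Y → g (t + 1) X = g (t + 1) Y := by
    rintro (_ | t) X Y h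
    · rw [hg0 h]
    · exact H.cluster_eq_cluster_of_le (hM1 _) (hManti t) (hMle t)
        (pointVertex_mem_layeredPoints X) (pointVertex_mem_layeredPoints Y) h
  have hg' : ∀ {t t'}, t ≤ t' → ∀ {X Y}, g t X = g t Y → g t' X = g t' Y := by
    intro t t' h X Y hXY
    induction h with
    | refl => exact hXY
    | step _ ih => exact hg _ _ _ ih
  obtain ⟨B, hBne, hB⟩ := exists_heavy_subset (fun t => g (t + 1)) (fun t => hg (t + 1))
    (layerCard (k + 1)) k fun t ht => by
      have h1 : (Finset.univ.image (g (t + 1))).card ≤ M t := by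
        refine (Finset.card_le_card fun C hC => ?_).trans
          (H.card_image_cluster_le (hM1 t) (hMle t))
        obtain ⟨X, -, rfl⟩ := Finset.mem_image.1 hC
        exact Finset.mem_image_of_mem _ (pointVertex_mem_layeredPoints X)
      rw [card_layerPoint, ← mul_assoc]
      refine (Nat.mul_le_mul_left _ h1).trans ?_
      rw [hMeq t ht]
      exact Nat.mul_div_le _ _
  -- The cost of the clusters of `H` at time `s + 1`.
  have hcost : ∀ s < k, ∀ X, cost _ (g (s + 1) X) ≤ α * (lam * ((s : ℝ) + 1)) := by
    intro s hs X
    refine happ.cost_cluster_le hα.le (hM1 s) (hMle s) (lineOf φ ⟨s, hs⟩) ?_ (by positivity)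
      (fun a ha C hC => ?_) (pointVertex_mem_layeredPoints X)
    · rw [hMeq s hs]
      exact hlines ⟨s, hs⟩
    · obtain ⟨Y, rfl⟩ := exists_of_mem_layeredPoints ha
      exact hline ⟨s, hs⟩ Y C fun v => (hC v).trans mem_layeredPoints_and_lineOf_eq
  have : Nonempty {X // X ∈ B} := hBne.to_subtype
  refine habs {X // X ∈ B} (fun t X r => ∀ W, ∃ Y ∈ B, g t Y = g t X.1 ∧
    r ≤ dist (pointVertex φ Y) (pointVertex φ W)) ?_ ?_ ?_
  · intro t X r r' hr h W
    obtain ⟨Y, h1, h2, h3⟩ := h W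
    exact ⟨Y, h1, h2, hr.trans h3⟩
  · exact fun t X W => ⟨X, X.2, rfl, dist_nonneg⟩
  · intro e he t ht X
    obtain ⟨s, hst, Z, hZ, hZX, ⟨Y, hY, Y', hY', hYY'⟩, hecc⟩ :=
      exists_growth_step hm hg0 hg hB (fun t ht X hX => he t ht ⟨X, hX⟩) ht X.2
    have hmem : ∀ {Y}, g (s + 1) Y = g (s + 1) Z → pointVertex φ Y ∈ g (s + 1) Z := fun h =>
      h ▸ H.mem_cluster_self (M s) (pointVertex_mem_layeredPoints _)
    refine ⟨s, hst, ?_, fun W => ?_⟩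
    · have h1 := hgrow (g (s + 1) Z) ⟨_, hmem rfl⟩ (H.cluster_subset (M s) _) _ _
        ⟨_, hmem hY, _, hmem hY', hYY'⟩ fun W => by
          obtain ⟨V, -, h2, h3⟩ := hecc W
          exact ⟨_, hmem h2, h3⟩
      have h2 := h1.trans (hcost s (hst.trans_lt ht) Z)
      rw [mul_left_comm] at h2
      exact le_of_mul_le_mul_left h2 hlam
    · obtain ⟨V, h1, h2, h3⟩ := hecc W
      exact ⟨V, h1, (hg' (Nat.succ_le_succ hst) h2).trans hZX, h3⟩

theorem exists_layered_lower_bound {ε : ℝ} (hε : 0 < ε) :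
    ∃ k : ℕ, ∀ φ : LayerNumbering (k + 1), ∃ m : MetricSpace (LayeredVertex k φ),
      (layeredHypergraph k φ).IsShortestPathMetric m ∧
        ∀ H : HierarchicalClustering (layeredPoints k φ),
          ¬ H.IsApproximation diamCost (3 + 2 * Real.sqrt 2 - ε) ∧
          ¬ H.IsApproximation radCost (3 + 2 * Real.sqrt 2 - ε) ∧
          ¬ H.IsApproximation dradCost (4 - ε) := by
  set w := Real.sqrt 2 with hw
  have hw2 : w * w = 2 := Real.mul_self_sqrt (by norm_num)
  have hw1 : 1 ≤ w := Real.one_le_sqrt.2 one_le_two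
  -- A smaller `ε` makes the factors positive.
  obtain ⟨η, hη, hη1, hηε⟩ : ∃ η : ℝ, 0 < η ∧ η ≤ 1 ∧ η ≤ ε :=
    ⟨min ε 1, lt_min hε one_pos, min_le_right _ _, min_le_left _ _⟩
  have hα₂ : 0 < 3 + 2 * w - η := by linarith
  have hα₁ : 0 < 4 - η := by linarith
  obtain ⟨k₂, hk₂⟩ := exists_forall_ge_growth_absurd (κ := 2) hα₂ two_pos (by nlinarith)
  obtain ⟨k₁, hk₁⟩ := exists_forall_ge_growth_absurd (κ := 1) hα₁ one_pos (by nlinarith)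
  obtain ⟨k, hkk₁, hkk₂⟩ : ∃ k, k₁ ≤ k ∧ k₂ ≤ k := ⟨max k₁ k₂, le_max_left _ _, le_max_right _ _⟩
  refine ⟨k, fun φ => ?_⟩
  obtain ⟨m, hm⟩ := exists_isShortestPathMetric_layeredHypergraph k φ
  refine ⟨m, hm, fun H => ⟨fun h => ?_, fun h => ?_, fun h => ?_⟩⟩
  · refine not_isApproximation_of_growth_absurd hm one_pos hα₂ (fun j X C hC => ?_)
      (fun C _ _ r e h1 _ => ?_) (hk₂ k hkk₂) H
      (isTransportBounded_diamCost.isApproximation_mono (by linarith) h)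
    · rw [one_mul]
      refine diamCost_le (by positivity) fun p hp q hq => ?_
      obtain ⟨Y, hY, rfl⟩ := (hC p).1 hp
      obtain ⟨Z, hZ, rfl⟩ := (hC q).1 hq
      exact dist_le_of_mem_line hm (by rwa [line_eq_of_mem_line hY])
    · obtain ⟨v, hv, v', hv', h2⟩ := h1
      rw [one_mul]
      exact h2.trans (dist_le_diamCost hv hv')
  · refine not_isApproximation_of_growth_absurd hm one_half_pos hα₂ (fun j X C hC => ?_)
      (fun C _ _ r e h1 _ => ?_) (hk₂ k hkk₂) H
      (isTransportBounded_radCost.isApproximation_mono (by linarith) h)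
    · refine (radCost_le_radiusAt C (Sum.inr ⟨j, line φ j X, X, rfl⟩)).trans
        (radiusAt_le (by positivity) fun p hp => ?_)
      obtain ⟨Y, hY, rfl⟩ := (hC p).1 hp
      exact (dist_center_le hm hY).trans (by linarith)
    · obtain ⟨v, hv, v', hv', h2⟩ := h1
      have := dist_le_two_mul_radCost hv hv'
      linarith
  · refine not_isApproximation_of_growth_absurd hm one_pos hα₁ (fun j X C hC => ?_)
      (fun C hne hCP r e _ h1 => ?_) (hk₁ k hkk₁) H
      (isTransportBounded_dradCost.isApproximation_mono (by linarith) h)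
    · rw [one_mul]
      refine (dradCost_le_radiusAt ((hC (pointVertex φ X)).2 ⟨X, mem_line_self j X, rfl⟩)).trans
        (radiusAt_le (by positivity) fun p hp => ?_)
      obtain ⟨Y, hY, rfl⟩ := (hC p).1 hp
      exact dist_le_of_mem_line hm hY
    · rw [one_mul, one_mul]
      refine le_dradCost hne fun c hc => ?_
      obtain ⟨W, rfl⟩ := exists_of_mem_layeredPoints (hCP hc)
      obtain ⟨v, hv, h2⟩ := h1 W
      rw [dist_comm] at h2
      exact h2.trans (dist_le_radiusAt hv)

theorem mainTheorem3 :
    IsPriceOfHierarchy diamCost (3 + 2 * Real.sqrt 2) ∧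
    IsPriceOfHierarchy radCost (3 + 2 * Real.sqrt 2) ∧
    (∃ ρ : ℝ, IsPriceOfHierarchy dradCost ρ ∧ 4 ≤ ρ) ∧
    (∀ ε : ℝ, 0 < ε → ∃ k : ℕ, ∀ φ : LayerNumbering (k + 1),
      ∃ m : MetricSpace (LayeredVertex k φ), (layeredHypergraph k φ).IsShortestPathMetric m ∧
        ∀ H : HierarchicalClustering (layeredPoints k φ),
          ¬ H.IsApproximation diamCost (3 + 2 * Real.sqrt 2 - ε) ∧
          ¬ H.IsApproximation radCost (3 + 2 * Real.sqrt 2 - ε) ∧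
          ¬ H.IsApproximation dradCost (4 - ε)) := by
  have hnum : ∀ Γ, Nonempty (LayerNumbering Γ) := fun Γ =>
    ⟨fun ℓ => Fintype.equivFinOfCardEq (card_layerPoint Γ ℓ)⟩
  have hone : (1 : ℝ) ≤ 3 + 2 * Real.sqrt 2 := by linarith [Real.sqrt_nonneg 2]
  refine ⟨⟨hone, fun X _ P => ?_, fun α hα => ?_⟩, ⟨hone, fun X _ P => ?_, fun α hα => ?_⟩,
    isTransportBounded_dradCost.exists_isPriceOfHierarchy (by norm_num) fun α hα => ?_,
    fun ε hε => exists_layered_lower_bound hε⟩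
  · simpa using isTransportBounded_diamCost.exists_isApproximation P
  · obtain ⟨k, hk⟩ := exists_layered_lower_bound (sub_pos.2 hα)
    obtain ⟨φ⟩ := hnum (k + 1)
    obtain ⟨m, -, hH⟩ := hk φ
    exact ⟨_, m, layeredPoints k φ, fun ⟨H, h⟩ => (hH H).1 (by rwa [sub_sub_cancel])⟩
  · simpa using isTransportBounded_radCost.exists_isApproximation P
  · obtain ⟨k, hk⟩ := exists_layered_lower_bound (sub_pos.2 hα)
    obtain ⟨φ⟩ := hnum (k + 1)
    obtain ⟨m, -, hH⟩ := hk φ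
    exact ⟨_, m, layeredPoints k φ, fun ⟨H, h⟩ => (hH H).2.1 (by rwa [sub_sub_cancel])⟩
  · obtain ⟨k, hk⟩ := exists_layered_lower_bound (sub_pos.2 hα)
    obtain ⟨φ⟩ := hnum (k + 1)
    obtain ⟨m, -, hH⟩ := hk φ
    exact ⟨_, m, layeredPoints k φ, fun ⟨H, h⟩ => (hH H).2.2 (by rwa [sub_sub_cancel])⟩
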